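/- Let $\Omega\subset\mathbb R^2$ be open and let $\mathbf u=(u,v):\Omega\to\mathbb R^2$, $(x,y)\mapsto(u,v)$, be a bivariate planar image of class $C^2$. For a closed disc $D_\varrho(p)\subset\Omega$ of radius $\varrho>0$ around $p$, an Oja median of the values of $\mathbf u$ in $D_\varrho(p)$ is a minimiser over $M\in\mathbb R^2$ of $$\int\!\!\int \bigl|[M,A,B]\bigr|\,\mathrm d\mu(A)\,\mathrm d\mu(B),$$ where $|[M,A,B]|$ is the area of the triangle with vertices $M,A,B$ and $\mu$ is the push-forward under $\mathbf u$ of the uniform distribution on $D_\varrho(p)$. One step of Oja median filtering of $\mathbf u$ at $p$ with the structuring element $D_\varrho$ replaces $\mathbf u(p)$ by this median. Let $p\in\Omega$ be a point with $\det \mathrm D\mathbf u(p)=u_xv_y-u_yv_x\neq0$. Then for all sufficiently small $\varrho>0$ the Oja median $\mathbf m_\varrho$ of the values of $\mathbf u$ in $D_\varrho(p)$ exists and is unique, and one step of Oja median filtering approximates, as $\varrho\to0$, an explicit time step of size $\tau=\varrho^2/24$ of a PDE system: with all derivatives evaluated at $p$, $$\mathbf m_\varrho=\mathbf u(p)+\frac{\varrho^2}{24}\begin{pmatrix}u_t\\v_t\end{pmatrix}+o(\varrho^2)\qquad(\varrho\to0^+),$$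 where $$\begin{pmatrix}u_t\\v_t\end{pmatrix}=2\begin{pmatrix}u_{xx}+u_{yy}\\v_{xx}+v_{yy}\end{pmatrix}-\mathbf A(\mathrm D\mathbf u)\begin{pmatrix}u_{xx}-u_{yy}\\v_{yy}-v_{xx}\end{pmatrix}-\mathbf B(\mathrm D\mathbf u)\begin{pmatrix}u_{xy}\\v_{xy}\end{pmatrix},$$ $$\mathbf A(\mathrm D\mathbf u)=\frac1{u_xv_y-u_yv_x}\begin{pmatrix}u_xv_y+u_yv_x&2u_xu_y\\2v_xv_y&u_xv_y+u_yv_x\end{pmatrix},$$ $$\mathbf B(\mathrm D\mathbf u)=\frac2{u_xv_y-u_yv_x}\begin{pmatrix}-u_xv_x+u_yv_y&u_x^2-u_y^2\\-v_x^2+v_y^2&u_xv_x-u_yv_y\end{pmatrix}.$$ In particular, if $\mathrm D\mathbf u(p)$ is the unit matrix, the system at $p$ is $u_t=u_{xx}+3u_{yy}-2v_{xy}$, $v_t=3v_{xx}+v_{yy}-2u_{xy}$. -/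

import Mathlib

open Filter Topology Asymptotics MeasureTheory ProbabilityTheory
open scoped Matrix

noncomputable section

namespace OjaFilter

/-- The Euclidean plane, used both for the image domain and for the image values. -/
abbrev Plane := EuclideanSpace ℝ (Fin 2)

/-- The area of the triangle with vertices `m`, `a`, `b`. -/
def triangleArea (m a b : Plane) : ℝ :=
  |(a 0 - m 0) * (b 1 - m 1) - (a 1 - m 1) * (b 0 - m 0)| / 2

/-- The objective function of the Oja median of a (compactly supported) distribution `μ` of data
in the plane: the area of the triangle `m a b`, integrated over all pairs of data `a`, `b`. -/
def ojaObjective (μ : Measure Plane) (m : Plane) : ℝ :=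
  ∫ a, ∫ b, triangleArea m a b ∂μ ∂μ

/-- `m` is an Oja median of the distribution `μ`: it is a minimiser, over the whole plane, of the
objective function. -/
def IsOjaMedian (μ : Measure Plane) (m : Plane) : Prop :=
  ∀ m' : Plane, ojaObjective μ m ≤ ojaObjective μ m'

/-- The distribution of the values of the image `u` in the disc of radius `ρ` around `p`:
the push-forward under `u` of the uniform distribution on that disc. -/
def valueDistribution (u : Plane → Plane) (p : Plane) (ρ : ℝ) : Measure Plane :=
  Measure.map u (cond volume (Metric.closedBall p ρ))

/-- `m` is a result at the location `p` of one step of Oja median filtering of `u` with the disc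
of radius `ρ` as structuring element. -/
def IsOjaFilterValue (u : Plane → Plane) (p : Plane) (ρ : ℝ) (m : Plane) : Prop :=
  IsOjaMedian (valueDistribution u p ρ) m

/-- The partial derivative in the `j`-th coordinate direction
(`j = 0` is `x`, `j = 1` is `y`), taken of both channels. -/
def partialDeriv (j : Fin 2) (u : Plane → Plane) (p : Plane) : Plane :=
  fderiv ℝ u p (EuclideanSpace.single j 1)

/-- The Jacobian matrix `!![u_x, u_y; v_x, v_y]`. -/
def jacobian (u : Plane → Plane) (p : Plane) : Matrix (Fin 2) (Fin 2) ℝ :=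
  Matrix.of fun i j => partialDeriv j u p i

/-- The coefficient matrix `A`, as a function of the Jacobian `D = !![u_x, u_y; v_x, v_y]`. -/
def coeffA (D : Matrix (Fin 2) (Fin 2) ℝ) : Matrix (Fin 2) (Fin 2) ℝ :=
  let ux := D 0 0
  let uy := D 0 1
  let vx := D 1 0
  let vy := D 1 1
  (1 / (ux * vy - uy * vx)) •
    !![ux * vy + uy * vx, 2 * ux * uy;
       2 * vx * vy,       ux * vy + uy * vx]

/-- The coefficient matrix `B`, as a function of the Jacobian `D = !![u_x, u_y; v_x, v_y]`. -/
def coeffB (D : Matrix (Fin 2) (Fin 2) ℝ) : Matrix (Fin 2) (Fin 2) ℝ :=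
  let ux := D 0 0
  let uy := D 0 1
  let vx := D 1 0
  let vy := D 1 1
  (2 / (ux * vy - uy * vx)) •
    !![-(ux * vx) + uy * vy, ux ^ 2 - uy ^ 2;
       -vx ^ 2 + vy ^ 2,     ux * vx - uy * vy]

/-- The right-hand side `(u_t, v_t)` of the PDE system, at the location `p`. -/
def pdeRHS (u : Plane → Plane) (p : Plane) : Plane :=
  let dxx := partialDeriv 0 (partialDeriv 0 u) p
  let dxy := partialDeriv 1 (partialDeriv 0 u) p
  let dyy := partialDeriv 1 (partialDeriv 1 u) p
  WithLp.toLp 2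
    ((2 : ℝ) • ![dxx 0 + dyy 0, dxx 1 + dyy 1]
      - coeffA (jacobian u p) *ᵥ ![dxx 0 - dyy 0, dyy 1 - dxx 1]
      - coeffB (jacobian u p) *ᵥ ![dxy 0, dxy 1])

/-- The value at `p` after one explicit time step of size `τ` of the PDE system, starting at `u`. -/
def explicitStep (u : Plane → Plane) (p : Plane) (τ : ℝ) : Plane :=
  u p + τ • pdeRHS u p

end OjaFilter

end

noncomputable section

namespace OjaFilter

/-! Put `L = Du(p)`, which is invertible. Affine maps multiply all areas by one constant, so the
objective may be studied in the coordinates given by `L`. There the value at `p + ρx`, for `x` in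
the unit disc, is `x + ρ W_ρ(x)` up to translation and scaling by `ρ`, where `W_ρ` tends uniformly
on the disc to the quadratic Taylor term `Q`. A candidate median is `u(p) + ρ² L n`, and up to a
positive factor its objective is `A_ρ(n) = ∬ |(x + ρ(W_ρ(x) - n)) × (y + ρ(W_ρ(y) - n))|`.

Expand each absolute value to first order around `x × y`. The contribution of `n` to the linear
terms is a sum of integrals of `sign(x × y) φ(x)` and `sign(x × y) φ(y)`, which vanish under `y ↦
-y` and `x ↦ -x` (`areaIntegral_sub_const`). What remains is the defect of the expansion, which is
nonzero only where `x × y` has order `ρ`, that is, for nearly collinear `x` and `y`. Blowing up this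
strip and using `∫ signDefect a s da = s²` shows that the defects divided by `ρ²` converge to a
quadratic functional living on collinear pairs (`tendsto_defectIntegral`). For the displacement `Q -
n` this limit is a constant plus `(4/3)π |n - n₀|²` with an explicit `n₀`
(`limitObjective_quadMap_sub`).

Each `A_ρ` is convex, and the convergence allows `n` to move; hence minimisers exist and tend to
`n₀` (`eventually_minimisers_near`). Uniqueness at fixed small `ρ` is a strict convexity argument
resting on the local surjectivity of `u` (`minimiser_areaIntegral_unique`). Finally `24 L n₀` is the
right-hand side of the PDE system (`pdeRHS_eq`). -/

/-- The oriented area of the parallelogram spanned by two vectors of `ℝ × ℝ`. -/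
def cross (a b : ℝ × ℝ) : ℝ := a.1 * b.2 - a.2 * b.1

/-- The closed unit disc, as a subset of `ℝ × ℝ`. -/
def disc : Set (ℝ × ℝ) := {x | x.1 ^ 2 + x.2 ^ 2 ≤ 1}

/-! ### First order defect of the absolute value -/

/-- The error of the first order expansion of the absolute value at `a`. -/
def signDefect (a s : ℝ) : ℝ := |a + s| - |a| - Real.sign a * s

theorem measurable_real_sign : Measurable Real.sign :=
  Measurable.ite measurableSet_Iio measurable_const
    (Measurable.ite measurableSet_Ioi measurable_const measurable_const)

theorem measurable_signDefect {α : Type*} [MeasurableSpace α] {f g : α → ℝ} (hf : Measurable f)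
    (hg : Measurable g) : Measurable fun x => signDefect (f x) (g x) :=
  ((hf.add hg).norm.sub hf.norm).sub ((measurable_real_sign.comp hf).mul hg)

theorem continuous_signDefect (a : ℝ) : Continuous (signDefect a) := by
  unfold signDefect; fun_prop

theorem signDefect_mul_mul {c : ℝ} (hc : 0 < c) (a s : ℝ) :
    signDefect (c * a) (c * s) = c * signDefect a s := by
  have : Real.sign (c * a) = Real.sign a := by
    rcases lt_trichotomy a 0 with h | rfl | h
    · rw [Real.sign_of_neg h, Real.sign_of_neg (mul_neg_of_pos_of_neg hc h)]
    · simp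
    · rw [Real.sign_of_pos h, Real.sign_of_pos (mul_pos hc h)]
  unfold signDefect
  rw [this, ← mul_add, abs_mul, abs_mul, abs_of_pos hc]
  ring

theorem signDefect_neg_neg (a s : ℝ) : signDefect (-a) (-s) = signDefect a s := by
  unfold signDefect
  rw [Real.sign_neg, abs_neg, ← neg_add, abs_neg]
  ring

theorem abs_signDefect_le (a s : ℝ) : |signDefect a s| ≤ 2 * |s| := by
  have h1 : |(|a + s| - |a|)| ≤ |s| := by
    simpa using abs_abs_sub_abs_le_abs_sub (a + s) a
  have h2 : |Real.sign a * s| ≤ |s| := by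
    rw [abs_mul]
    refine mul_le_of_le_one_left (abs_nonneg _) ?_
    rcases Real.sign_apply_eq a with h | h | h <;> simp [h]
  unfold signDefect
  calc _ ≤ |(|a + s| - |a|)| + |Real.sign a * s| := abs_sub _ _
    _ ≤ _ := by linarith

/-- An increment smaller than `|a|` cannot change the sign, and the absolute value is linear on each
side of zero. This localises the defect to `|a| ≤ |s|`. -/
theorem signDefect_eq_zero {a s : ℝ} (h : |s| < |a|) : signDefect a s = 0 := by
  unfold signDefect
  have hs := abs_lt.1 h
  rcases lt_trichotomy a 0 with ha | rfl | ha
  · rw [Real.sign_of_neg ha, abs_of_neg ha] at *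
    rw [abs_of_neg (by linarith)]; ring
  · simp at h; exact absurd h (not_lt.2 (abs_nonneg _))
  · rw [Real.sign_of_pos ha, abs_of_pos ha] at *
    rw [abs_of_pos (by linarith)]; ring

theorem abs_signDefect_le_indicator {a s C : ℝ} (h : |s| ≤ C) :
    |signDefect a s| ≤ (Set.Icc (-C) C).indicator (fun _ => 2 * C) a := by
  by_cases ha : a ∈ Set.Icc (-C) C
  · rw [Set.indicator_of_mem ha]
    exact (abs_signDefect_le a s).trans (by linarith)
  · rw [Set.indicator_of_notMem ha, signDefect_eq_zero, abs_zero]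
    refine h.trans_lt ?_
    by_contra! h'
    exact ha (abs_le.1 h')

/-- The graph of the defect is a right triangle over `(-s, 0]` with legs `s` and `2s`. -/
theorem integral_signDefect_of_nonneg {s : ℝ} (hs : 0 ≤ s) : ∫ a, signDefect a s = s ^ 2 := by
  have h : (fun a => signDefect a s) =ᵐ[volume]
      (Set.Ioc (-s) 0).indicator fun a => 2 * (a + s) := by
    -- Since `Real.sign 0 = 0`, the defect at `a = 0` is `s` and not `2s`, so this point is
    -- discarded.
    filter_upwards [Measure.ae_ne volume (0 : ℝ)] with a ha
    rcases lt_or_gt_of_ne ha with h | h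
    · simp only [signDefect, Real.sign_of_neg h, abs_of_neg h, Set.indicator, Set.mem_Ioc]
      split_ifs with h'
      · rw [abs_of_pos (by linarith)]; ring
      · have : a ≤ -s := by by_contra! h''; exact h' ⟨h'', h.le⟩
        rw [abs_of_nonpos (by linarith)]; ring
    · rw [Set.indicator_of_notMem (fun h' => absurd h'.2 (not_le.2 h))]
      simp only [signDefect, Real.sign_of_pos h, abs_of_pos h]
      rw [abs_of_pos (by linarith)]; ring
  rw [integral_congr_ae h, integral_indicator measurableSet_Ioc,
    ← intervalIntegral.integral_of_le (by linarith)]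
  rw [intervalIntegral.integral_const_mul, intervalIntegral.integral_add (by simp) (by simp)]
  simp
  ring

theorem integral_signDefect (s : ℝ) : ∫ a, signDefect a s = s ^ 2 := by
  rcases le_total 0 s with h | h
  · exact integral_signDefect_of_nonneg h
  · rw [← integral_neg_eq_self, ← neg_sq, ← integral_signDefect_of_nonneg (neg_nonneg.2 h)]
    congr 1; ext a; rw [← signDefect_neg_neg, neg_neg]

/-! ### The unit disc and integration over pairs of its points -/

theorem isClosed_disc : IsClosed disc := isClosed_le (by fun_prop) continuous_const

theorem measurableSet_disc : MeasurableSet disc := isClosed_disc.measurableSet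

theorem norm_le_one_of_mem_disc {x : ℝ × ℝ} (hx : x ∈ disc) : ‖x‖ ≤ 1 := by
  have h : x.1 ^ 2 + x.2 ^ 2 ≤ 1 := hx
  rw [Prod.norm_def, Real.norm_eq_abs, Real.norm_eq_abs, max_le_iff, ← sq_le_one_iff_abs_le_one,
    ← sq_le_one_iff_abs_le_one]
  constructor <;> nlinarith [sq_nonneg x.1, sq_nonneg x.2]

theorem isCompact_disc : IsCompact disc :=
  (isCompact_closedBall (0 : ℝ × ℝ) 1).of_isClosed_subset isClosed_disc fun x hx => by
    simpa using norm_le_one_of_mem_disc hx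

/-- The restriction of Lebesgue measure to the unit disc. -/
def discMeasure : Measure (ℝ × ℝ) := volume.restrict disc

instance : IsFiniteMeasure discMeasure :=
  isFiniteMeasure_restrict.2 isCompact_disc.measure_lt_top.ne

theorem neg_mem_disc {x : ℝ × ℝ} : -x ∈ disc ↔ x ∈ disc := by simp [disc]

theorem measurePreserving_neg_discMeasure :
    MeasurePreserving (fun x : ℝ × ℝ => -x) discMeasure discMeasure := by
  have h := (Measure.measurePreserving_neg (volume : Measure (ℝ × ℝ))).restrict_preimage
    measurableSet_disc
  have e : (Neg.neg : ℝ × ℝ → ℝ × ℝ) ⁻¹' disc = disc := by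
    ext x; exact neg_mem_disc
  rw [e] at h
  exact h

theorem abs_cross_le {a b : ℝ × ℝ} : |cross a b| ≤ 2 * (‖a‖ * ‖b‖) := by
  have h1 : |a.1 * b.2| ≤ ‖a‖ * ‖b‖ := by
    rw [abs_mul]; exact mul_le_mul (norm_fst_le a) (norm_snd_le b) (abs_nonneg _) (norm_nonneg _)
  have h2 : |a.2 * b.1| ≤ ‖a‖ * ‖b‖ := by
    rw [abs_mul]; exact mul_le_mul (norm_snd_le a) (norm_fst_le b) (abs_nonneg _) (norm_nonneg _)
  unfold cross
  calc _ ≤ |a.1 * b.2| + |a.2 * b.1| := abs_sub _ _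
    _ ≤ _ := by linarith

theorem continuous_cross : Continuous fun z : (ℝ × ℝ) × (ℝ × ℝ) => cross z.1 z.2 := by
  unfold cross; fun_prop

theorem measurable_cross {α : Type*} [MeasurableSpace α] {f g : α → ℝ × ℝ} (hf : Measurable f)
    (hg : Measurable g) : Measurable fun x => cross (f x) (g x) :=
  continuous_cross.measurable.comp (hf.prodMk hg)

theorem ae_mem_disc_prod :
    ∀ᵐ z ∂(discMeasure.prod discMeasure), z.1 ∈ disc ∧ z.2 ∈ disc := by
  rw [discMeasure, Measure.prod_restrict]
  filter_upwards [ae_restrict_mem (measurableSet_disc.prod measurableSet_disc)] with z hz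
  exact hz

theorem integrable_disc_prod {F : (ℝ × ℝ) × (ℝ × ℝ) → ℝ} (hF : Measurable F) {C : ℝ}
    (hC : ∀ x ∈ disc, ∀ y ∈ disc, |F (x, y)| ≤ C) :
    Integrable F (discMeasure.prod discMeasure) :=
  Integrable.of_bound hF.aestronglyMeasurable C <| by
    filter_upwards [ae_mem_disc_prod] with z hz using hC _ hz.1 _ hz.2

/-! ### Blow-up of the defect integral near collinear pairs -/

/-- The unit vector with argument `θ`, scaled by `r`, where `q = (r, θ)`. -/
def polar (q : ℝ × ℝ) : ℝ × ℝ := (q.1 * Real.cos q.2, q.1 * Real.sin q.2)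

/-- The vector with coordinates `z.1` and `k * z.2` in the orthonormal frame rotated by `θ`. -/
def frame (k θ : ℝ) (z : ℝ × ℝ) : ℝ × ℝ :=
  (z.1 * Real.cos θ - k * z.2 * Real.sin θ, z.1 * Real.sin θ + k * z.2 * Real.cos θ)

/-- The frame map is a rotation composed with `diag(1, k)`, so its determinant is `k`. -/
theorem integral_comp_frame {k : ℝ} (hk : 0 < k) (θ : ℝ) (g : ℝ × ℝ → ℝ) :
    ∫ y, g y = k * ∫ z, g (frame k θ z) := by
  let T : ℝ × ℝ →L[ℝ] ℝ × ℝ := (Matrix.toLin (.finTwoProd ℝ) (.finTwoProd ℝ)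
    !![Real.cos θ, -k * Real.sin θ; Real.sin θ, k * Real.cos θ]).toContinuousLinearMap
  have hT : ∀ z, frame k θ z = T z := by
    intro z
    simp only [T, Matrix.toLin_finTwoProd_toContinuousLinearMap, frame]
    simp only [ContinuousLinearMap.prod_apply, add_apply,
      smul_apply, ContinuousLinearMap.coe_fst', ContinuousLinearMap.coe_snd',
      smul_eq_mul]
    ext <;> simp only <;> ring
  have hdet : T.det = k := by
    simp only [T, LinearMap.det_toContinuousLinearMap, LinearMap.det_toLin,
      Matrix.det_fin_two_of]
    linear_combination k * Real.cos_sq_add_sin_sq θ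
  have hdet' : LinearMap.det (T : ℝ × ℝ →ₗ[ℝ] ℝ × ℝ) = k := hdet
  have hb : Function.Bijective T :=
    (LinearMap.equivOfDetNeZero (T : ℝ × ℝ →ₗ[ℝ] ℝ × ℝ) (by rw [hdet']; exact hk.ne')).bijective
  have := integral_image_eq_integral_abs_det_fderiv_smul volume MeasurableSet.univ
    (fun x _ => T.hasFDerivAt.hasFDerivWithinAt) hb.1.injOn g
  rw [Set.image_univ, hb.2.range_eq, setIntegral_univ, setIntegral_univ, hdet, abs_of_pos hk] at this
  rw [this]
  simp only [hT, smul_eq_mul, integral_const_mul]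

/-- The difference quotient of the oriented area of the parallelogram spanned by `x` and `y` when
`x` and `y` are displaced by `ρ • V x` and `ρ • V y`. -/
def slope (ρ : ℝ) (V : ℝ × ℝ → ℝ × ℝ) (x y : ℝ × ℝ) : ℝ :=
  cross x (V y) + cross (V x) y + ρ * cross (V x) (V y)

theorem cross_displaced (ρ : ℝ) (V : ℝ × ℝ → ℝ × ℝ) (x y : ℝ × ℝ) :
    cross (x + ρ • V x) (y + ρ • V y) = cross x y + ρ * slope ρ V x y := by
  simp only [cross, slope, Prod.fst_add, Prod.snd_add, Prod.smul_fst, Prod.smul_snd, smul_eq_mul]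
  ring

theorem abs_slope_le {ρ : ℝ} (hρ : |ρ| ≤ 1) {V : ℝ × ℝ → ℝ × ℝ} {C : ℝ}
    (hC : ∀ x ∈ disc, ‖V x‖ ≤ C) {x y : ℝ × ℝ} (hx : x ∈ disc) (hy : y ∈ disc) :
    |slope ρ V x y| ≤ 4 * C + 2 * C ^ 2 := by
  have hC0 : 0 ≤ C := (norm_nonneg _).trans (hC x hx)
  have hx1 := norm_le_one_of_mem_disc hx
  have hy1 := norm_le_one_of_mem_disc hy
  have h1 : |cross x (V y)| ≤ 2 * C := abs_cross_le.trans <| by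
    have := mul_le_mul hx1 (hC y hy) (norm_nonneg _) zero_le_one
    linarith
  have h2 : |cross (V x) y| ≤ 2 * C := abs_cross_le.trans <| by
    have := mul_le_mul (hC x hx) hy1 (norm_nonneg _) hC0
    linarith
  have h3 : |ρ * cross (V x) (V y)| ≤ 2 * C ^ 2 := by
    rw [abs_mul]
    have h4 : |cross (V x) (V y)| ≤ 2 * C ^ 2 := abs_cross_le.trans <| by
      have := mul_le_mul (hC x hx) (hC y hy) (norm_nonneg _) hC0
      linarith
    calc |ρ| * |cross (V x) (V y)| ≤ 1 * (2 * C ^ 2) :=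
          mul_le_mul hρ h4 (abs_nonneg _) zero_le_one
      _ = _ := one_mul _
  unfold slope
  calc _ ≤ |cross x (V y) + cross (V x) y| + |ρ * cross (V x) (V y)| := abs_add_le _ _
    _ ≤ |cross x (V y)| + |cross (V x) y| + |ρ * cross (V x) (V y)| := by
        gcongr; exact abs_add_le _ _
    _ ≤ _ := by linarith

theorem measurable_slope (ρ : ℝ) {V : ℝ × ℝ → ℝ × ℝ} (hV : Measurable V) {α : Type*}
    [MeasurableSpace α] {f g : α → ℝ × ℝ} (hf : Measurable f) (hg : Measurable g) :
    Measurable fun a => slope ρ V (f a) (g a) :=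
  ((measurable_cross hf (hV.comp hg)).add (measurable_cross (hV.comp hf) hg)).add
    ((measurable_cross (hV.comp hf) (hV.comp hg)).const_mul ρ)

/-- The total error of the first order expansion of `|cross x y|` over the pairs of points of the
disc, under the displacement `ρ • V`. -/
def defectIntegral (ρ : ℝ) (V : ℝ × ℝ → ℝ × ℝ) : ℝ :=
  ∫ z, signDefect (cross z.1 z.2) (ρ * slope ρ V z.1 z.2) ∂(discMeasure.prod discMeasure)

theorem integrable_defect (ρ : ℝ) {V : ℝ × ℝ → ℝ × ℝ} (hV : Measurable V) {C : ℝ}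
    (hρ : |ρ| ≤ 1) (hC : ∀ x ∈ disc, ‖V x‖ ≤ C) :
    Integrable (fun z : (ℝ × ℝ) × (ℝ × ℝ) =>
      signDefect (cross z.1 z.2) (ρ * slope ρ V z.1 z.2)) (discMeasure.prod discMeasure) := by
  refine integrable_disc_prod (C := 2 * (|ρ| * (4 * C + 2 * C ^ 2)))
    (measurable_signDefect (measurable_cross measurable_fst measurable_snd)
      ((measurable_slope ρ hV measurable_fst measurable_snd).const_mul ρ)) ?_
  intro x hx y hy
  refine (abs_signDefect_le _ _).trans ?_
  rw [abs_mul]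
  gcongr
  exact abs_slope_le hρ hC hx hy

/-- The range of the polar coordinates of the disc. -/
def polarRange : Set (ℝ × ℝ) := Set.Ioc 0 1 ×ˢ Set.Ioo (-Real.pi) Real.pi

/-- The pair of polar coordinates `w.1` and rescaled frame coordinates `w.2`, mapped to the
second point of the pair. -/
def frameMap (ρ : ℝ) (w : (ℝ × ℝ) × (ℝ × ℝ)) : ℝ × ℝ := frame (ρ / w.1.1) w.1.2 w.2

/-- The integrand of the defect integral in polar coordinates for the first point and a rescaled
rotated frame for the second point. -/
def polarDefect (ρ : ℝ) (V : ℝ × ℝ → ℝ × ℝ) (w : (ℝ × ℝ) × (ℝ × ℝ)) : ℝ :=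
  (frameMap ρ ⁻¹' disc).indicator
    (fun w => signDefect w.2.2 (slope ρ V (polar w.1) (frameMap ρ w))) w

theorem measurable_frameMap (ρ : ℝ) : Measurable (frameMap ρ) := by
  unfold frameMap frame
  fun_prop

theorem measurable_polar : Measurable polar := by
  unfold polar
  fun_prop

theorem measurable_polarDefect (ρ : ℝ) {V : ℝ × ℝ → ℝ × ℝ} (hV : Measurable V) :
    Measurable (polarDefect ρ V) :=
  Measurable.indicator
    (measurable_signDefect (measurable_snd.comp measurable_snd)
      (measurable_slope ρ hV (measurable_polar.comp measurable_fst) (measurable_frameMap ρ)))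
    (measurable_frameMap ρ measurableSet_disc)

theorem polar_mem_disc {q : ℝ × ℝ} (hq : 0 < q.1) : polar q ∈ disc ↔ q.1 ≤ 1 := by
  have : (q.1 * Real.cos q.2) ^ 2 + (q.1 * Real.sin q.2) ^ 2 = q.1 ^ 2 := by
    linear_combination q.1 ^ 2 * Real.cos_sq_add_sin_sq q.2
  simp only [disc, polar, Set.mem_ofPred_eq, this]
  exact sq_le_one_iff₀ hq.le

theorem frame_mem_disc {k θ : ℝ} {z : ℝ × ℝ} :
    frame k θ z ∈ disc ↔ z.1 ^ 2 + (k * z.2) ^ 2 ≤ 1 := by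
  have : (z.1 * Real.cos θ - k * z.2 * Real.sin θ) ^ 2
      + (z.1 * Real.sin θ + k * z.2 * Real.cos θ) ^ 2 = z.1 ^ 2 + (k * z.2) ^ 2 := by
    linear_combination (z.1 ^ 2 + (k * z.2) ^ 2) * Real.cos_sq_add_sin_sq θ
  simp only [disc, frame, Set.mem_ofPred_eq, this]

theorem cross_polar_frame (q : ℝ × ℝ) (k : ℝ) (z : ℝ × ℝ) :
    cross (polar q) (frame k q.2 z) = q.1 * (k * z.2) := by
  simp only [cross, polar, frame]
  linear_combination q.1 * (k * z.2) * Real.cos_sq_add_sin_sq q.2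

theorem setIntegral_disc_eq_polar (h : ℝ × ℝ → ℝ) :
    ∫ x in disc, h x = ∫ q in polarRange, q.1 * h (polar q) := by
  rw [← integral_indicator measurableSet_disc, ← integral_comp_polarCoord_symm]
  have e : ∀ q : ℝ × ℝ, q.1 • disc.indicator h (polarCoord.symm q)
      = (polar ⁻¹' disc).indicator (fun q => q.1 * h (polar q)) q := by
    intro q
    by_cases hq : polar q ∈ disc
    · rw [Set.indicator_of_mem (show q ∈ polar ⁻¹' disc from hq)]
      rw [Set.indicator_of_mem (show polarCoord.symm q ∈ disc from hq)]
      rfl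
    · rw [Set.indicator_of_notMem (show q ∉ polar ⁻¹' disc from hq)]
      rw [Set.indicator_of_notMem (show polarCoord.symm q ∉ disc from hq), smul_zero]
  simp only [e]
  rw [setIntegral_indicator (measurable_polar measurableSet_disc)]
  congr 2
  ext q
  simp only [polarRange, polarCoord_target, Set.mem_inter_iff, Set.mem_prod, Set.mem_Ioi,
    Set.mem_Ioc, Set.mem_preimage]
  constructor
  · rintro ⟨⟨h1, h2⟩, h3⟩
    exact ⟨⟨h1, (polar_mem_disc h1).1 h3⟩, h2⟩
  · rintro ⟨⟨h1, h3⟩, h2⟩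
    exact ⟨⟨h1, h2⟩, (polar_mem_disc h1).2 h3⟩

theorem measurableSet_polarRange : MeasurableSet polarRange :=
  measurableSet_Ioc.prod measurableSet_Ioo

theorem volume_polarRange_lt_top : volume polarRange < ⊤ := by
  rw [polarRange, Measure.volume_eq_prod, Measure.prod_prod]
  exact ENNReal.mul_lt_top (by simp) (by simp)

/-- With `k = ρ / r` the cross product of the pair is exactly `ρ * z.2`, so homogeneity extracts one
factor `ρ` from the defect. The other comes from the Jacobian `ρ / r`, whose denominator cancels the
polar weight `r`. The limit therefore carries no weight in `r`. -/
theorem defectIntegral_eq_polar {ρ : ℝ} (hρ : 0 < ρ) (hρ1 : ρ ≤ 1) {V : ℝ × ℝ → ℝ × ℝ}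
    (hV : Measurable V) {C : ℝ} (hC : ∀ x ∈ disc, ‖V x‖ ≤ C) :
    (ρ ^ 2)⁻¹ * defectIntegral ρ V = ∫ q in polarRange, ∫ z, polarDefect ρ V (q, z) := by
  have hint := integrable_defect ρ hV (by rwa [abs_of_pos hρ]) hC
  rw [defectIntegral, integral_prod _ hint]
  simp only [discMeasure]
  rw [setIntegral_disc_eq_polar, ← integral_const_mul]
  refine setIntegral_congr_fun measurableSet_polarRange fun q hq => ?_
  have hr : 0 < q.1 := hq.1.1
  have hk : 0 < ρ / q.1 := div_pos hρ hr
  rw [← integral_indicator measurableSet_disc, integral_comp_frame hk q.2, ← mul_assoc, ← mul_assoc,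
    ← integral_const_mul]
  congr 1
  ext z
  by_cases hz : frame (ρ / q.1) q.2 z ∈ disc
  · rw [Set.indicator_of_mem hz, polarDefect, Set.indicator_of_mem (by exact hz), cross_polar_frame,
      show q.1 * (ρ / q.1 * z.2) = ρ * z.2 by field_simp, signDefect_mul_mul hρ]
    simp only [frameMap]
    field_simp
  · rw [Set.indicator_of_notMem hz, polarDefect, Set.indicator_of_notMem (by exact hz), mul_zero]

/-- A dominating function for the integrand in polar coordinates. -/
def defectBound (B : ℝ) (z : ℝ × ℝ) : ℝ :=
  (Set.Icc (-1 : ℝ) 1 ×ˢ Set.Icc (-B) B).indicator (fun _ => 2 * B) z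

theorem integrable_defectBound (B : ℝ) : Integrable (defectBound B) := by
  refine (integrable_indicator_iff (measurableSet_Icc.prod measurableSet_Icc)).2 ?_
  exact continuousOn_const.integrableOn_compact (isCompact_Icc.prod isCompact_Icc)

/-- Membership in the disc bounds the coordinate along the ray by 1, and the defect vanishes once
`|z.2|` exceeds the bound on the slope. The resulting majorant depends neither on `ρ` nor on `q`. -/
theorem abs_polarDefect_le {ρ : ℝ} (hρ1 : |ρ| ≤ 1) {V : ℝ × ℝ → ℝ × ℝ}
    {C : ℝ} (hC : ∀ x ∈ disc, ‖V x‖ ≤ C) {q : ℝ × ℝ} (hq : q ∈ polarRange) (z : ℝ × ℝ) :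
    |polarDefect ρ V (q, z)| ≤ defectBound (4 * C + 2 * C ^ 2) z := by
  have hx : polar q ∈ disc := (polar_mem_disc hq.1.1).2 hq.1.2
  have hC0 : 0 ≤ C := (norm_nonneg _).trans (hC _ hx)
  by_cases hz : frame (ρ / q.1) q.2 z ∈ disc
  · rw [polarDefect, Set.indicator_of_mem (by exact hz)]
    refine (abs_signDefect_le_indicator (abs_slope_le hρ1 hC hx hz)).trans ?_
    have h1 : z.1 ∈ Set.Icc (-1 : ℝ) 1 := by
      rw [frame_mem_disc] at hz
      rw [Set.mem_Icc, ← abs_le, ← sq_le_one_iff_abs_le_one]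
      nlinarith [sq_nonneg (ρ / q.1 * z.2)]
    refine le_of_eq ?_
    unfold defectBound
    by_cases h2 : z.2 ∈ Set.Icc (-(4 * C + 2 * C ^ 2)) (4 * C + 2 * C ^ 2)
    · rw [Set.indicator_of_mem h2, Set.indicator_of_mem (Set.mk_mem_prod h1 h2)]
    · rw [Set.indicator_of_notMem h2, Set.indicator_of_notMem (fun h => h2 h.2)]
  · rw [polarDefect, Set.indicator_of_notMem (by exact hz), abs_zero]
    exact Set.indicator_nonneg (fun _ _ => by positivity) _

/-- The limit of `slope` at points of the same line through the origin; its square is the density of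
the limit of the rescaled defect integrals. -/
def limitSlope (V : ℝ × ℝ → ℝ × ℝ) (q : ℝ × ℝ) (t : ℝ) : ℝ :=
  slope 0 V (polar q) (polar (t, q.2))

/-- The integrand of the limit of the rescaled defect integrals. -/
def limitDefect (V : ℝ × ℝ → ℝ × ℝ) (q z : ℝ × ℝ) : ℝ :=
  (Set.Ioo (-1 : ℝ) 1 ×ˢ Set.univ).indicator
    (fun z => signDefect z.2 (limitSlope V q z.1)) z

theorem polar_mem_disc_of_mem_Ioo {t θ : ℝ} (ht : t ∈ Set.Ioo (-1 : ℝ) 1) :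
    polar (t, θ) ∈ disc := by
  have : (t * Real.cos θ) ^ 2 + (t * Real.sin θ) ^ 2 = t ^ 2 := by
    linear_combination t ^ 2 * Real.cos_sq_add_sin_sq θ
  simp only [disc, polar, Set.mem_ofPred_eq, this]
  exact (sq_le_one_iff_abs_le_one t).2 (abs_le.2 ⟨ht.1.le, ht.2.le⟩)

/-- In the limit the slope no longer depends on the transversal coordinate, so Fubini reduces the
inner integral to `integral_signDefect`. -/
theorem integral_limitDefect {V : ℝ × ℝ → ℝ × ℝ} (hV : Measurable V) {C : ℝ}
    (hC : ∀ x ∈ disc, ‖V x‖ ≤ C) {q : ℝ × ℝ} (hq : q ∈ polarRange) :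
    ∫ z, limitDefect V q z = ∫ t in Set.Ioo (-1 : ℝ) 1, limitSlope V q t ^ 2 := by
  have hx : polar q ∈ disc := (polar_mem_disc hq.1.1).2 hq.1.2
  have hC0 : 0 ≤ C := (norm_nonneg _).trans (hC _ hx)
  have hm : Measurable (limitDefect V q) := by
    refine Measurable.indicator (measurable_signDefect measurable_snd ?_)
      (measurableSet_Ioo.prod MeasurableSet.univ)
    exact measurable_slope 0 hV measurable_const (measurable_polar.comp
      (measurable_fst.prodMk measurable_const))
  have hint : Integrable (limitDefect V q) := by
    refine (integrable_defectBound (4 * C + 2 * C ^ 2)).mono' hm.aestronglyMeasurable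
      (ae_of_all _ fun z => ?_)
    by_cases hz : z ∈ (Set.Ioo (-1 : ℝ) 1 ×ˢ Set.univ : Set (ℝ × ℝ))
    · rw [limitDefect, Set.indicator_of_mem hz]
      refine (abs_signDefect_le_indicator (abs_slope_le (by simp) hC hx
        (polar_mem_disc_of_mem_Ioo hz.1))).trans ?_
      refine le_of_eq ?_
      unfold defectBound
      by_cases h2 : z.2 ∈ Set.Icc (-(4 * C + 2 * C ^ 2)) (4 * C + 2 * C ^ 2)
      · rw [Set.indicator_of_mem h2,
          Set.indicator_of_mem (Set.mk_mem_prod (Set.Ioo_subset_Icc_self hz.1) h2)]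
      · rw [Set.indicator_of_notMem h2, Set.indicator_of_notMem (fun h => h2 h.2)]
    · rw [limitDefect, Set.indicator_of_notMem hz, norm_zero]
      exact Set.indicator_nonneg (fun _ _ => by positivity) _
  rw [Measure.volume_eq_prod, integral_prod _ hint, ← integral_indicator measurableSet_Ioo]
  congr 1
  ext t
  by_cases ht : t ∈ Set.Ioo (-1 : ℝ) 1
  · rw [Set.indicator_of_mem ht, ← integral_signDefect]
    congr 1; ext a
    rw [limitDefect, Set.indicator_of_mem (Set.mk_mem_prod ht (Set.mem_univ _))]
  · rw [Set.indicator_of_notMem ht]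
    refine integral_eq_zero_of_ae (ae_of_all _ fun a => ?_)
    exact Set.indicator_of_notMem (fun h => ht h.1) _

variable {ι : Type*} {l : Filter ι}

/-- As `ρ / r → 0` the second point moves to the line through the first point and the origin.
Because it moves, `V` has to converge along convergent sequences of points and not only pointwise.
On the lines `z.1 = ±1` membership in the disc need not stabilise; they are excluded as a null set.
-/
theorem tendsto_polarDefect {ρ : ι → ℝ} (hρ : Tendsto ρ l (𝓝 0))
    {V : ι → ℝ × ℝ → ℝ × ℝ} {V₀ : ℝ × ℝ → ℝ × ℝ}
    (hlim : ∀ x ∈ disc, ∀ y : ι → ℝ × ℝ, Tendsto y l (𝓝[disc] x) →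
      Tendsto (fun i => V i (y i)) l (𝓝 (V₀ x)))
    {q : ℝ × ℝ} (hq : q ∈ polarRange) {z : ℝ × ℝ} (h1 : z.1 ≠ 1) (h1' : z.1 ≠ -1) :
    Tendsto (fun i => polarDefect (ρ i) (V i) (q, z)) l (𝓝 (limitDefect V₀ q z)) := by
  have hx : polar q ∈ disc := (polar_mem_disc hq.1.1).2 hq.1.2
  have hk : Tendsto (fun i => ρ i / q.1) l (𝓝 0) := by simpa using hρ.div_const q.1
  have hsq : Tendsto (fun i => z.1 ^ 2 + (ρ i / q.1 * z.2) ^ 2) l (𝓝 (z.1 ^ 2)) := by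
    simpa using ((hk.mul_const z.2).pow 2).const_add (z.1 ^ 2)
  have hframe : Tendsto (fun i => frame (ρ i / q.1) q.2 z) l (𝓝 (polar (z.1, q.2))) := by
    have hc : Continuous fun k : ℝ => frame k q.2 z := by unfold frame; fun_prop
    have := (hc.tendsto 0).comp hk
    simpa [frame, polar, Function.comp_def] using this
  by_cases hz : z.1 ∈ Set.Ioo (-1 : ℝ) 1
  · have hz2 : z.1 ^ 2 < 1 := (sq_lt_one_iff_abs_lt_one _).2 (abs_lt.2 hz)
    have hev : ∀ᶠ i in l, frame (ρ i / q.1) q.2 z ∈ disc := by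
      filter_upwards [hsq.eventually_lt_const hz2] with i hi
      exact frame_mem_disc.2 hi.le
    rw [limitDefect, Set.indicator_of_mem (Set.mk_mem_prod hz (Set.mem_univ _))]
    have hVx := hlim (polar q) hx (fun _ => polar q)
      (tendsto_nhdsWithin_iff.2 ⟨tendsto_const_nhds, Eventually.of_forall fun _ => hx⟩)
    have hVy := hlim _ (polar_mem_disc_of_mem_Ioo (θ := q.2) hz) _
      (tendsto_nhdsWithin_iff.2 ⟨hframe, hev⟩)
    have hcr : ∀ {a b : ι → ℝ × ℝ} {a₀ b₀ : ℝ × ℝ}, Tendsto a l (𝓝 a₀) → Tendsto b l (𝓝 b₀) →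
        Tendsto (fun i => cross (a i) (b i)) l (𝓝 (cross a₀ b₀)) := fun ha hb =>
      (continuous_cross.tendsto (_, _)).comp (ha.prodMk_nhds hb)
    have hs : Tendsto (fun i => slope (ρ i) (V i) (polar q) (frame (ρ i / q.1) q.2 z)) l
        (𝓝 (limitSlope V₀ q z.1)) :=
      ((hcr tendsto_const_nhds hVy).add (hcr hVx hframe)).add (hρ.mul (hcr hVx hVy))
    refine (((continuous_signDefect z.2).tendsto _).comp hs).congr' ?_
    filter_upwards [hev] with i hi
    rw [polarDefect, Set.indicator_of_mem (by exact hi)]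
    rfl
  · have hz2 : 1 < z.1 ^ 2 := by
      rw [one_lt_sq_iff_one_lt_abs, lt_abs]
      by_contra! h
      exact hz ⟨lt_of_le_of_ne (by linarith) h1'.symm, lt_of_le_of_ne h.1 h1⟩
    rw [limitDefect, Set.indicator_of_notMem (fun h => hz h.1)]
    refine tendsto_const_nhds.congr' ?_
    filter_upwards [hsq.eventually_const_lt hz2] with i hi
    rw [polarDefect, Set.indicator_of_notMem]
    exact fun h => absurd (frame_mem_disc.1 h) (not_le.2 hi)

theorem tendsto_defectIntegral [l.IsCountablyGenerated] {ρ : ι → ℝ} (hρ : Tendsto ρ l (𝓝[>] 0))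
    {V : ι → ℝ × ℝ → ℝ × ℝ} {V₀ : ℝ × ℝ → ℝ × ℝ} (hV : ∀ᶠ i in l, Measurable (V i))
    (hV₀ : Measurable V₀) {C : ℝ} (hC : ∀ᶠ i in l, ∀ x ∈ disc, ‖V i x‖ ≤ C)
    (hC₀ : ∀ x ∈ disc, ‖V₀ x‖ ≤ C)
    (hlim : ∀ x ∈ disc, ∀ y : ι → ℝ × ℝ, Tendsto y l (𝓝[disc] x) →
      Tendsto (fun i => V i (y i)) l (𝓝 (V₀ x))) :
    Tendsto (fun i => (ρ i ^ 2)⁻¹ * defectIntegral (ρ i) (V i)) l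
      (𝓝 (∫ q in polarRange, ∫ t in Set.Ioo (-1 : ℝ) 1, limitSlope V₀ q t ^ 2)) := by
  have hρ0 : Tendsto ρ l (𝓝 0) := tendsto_nhds_of_tendsto_nhdsWithin hρ
  have hpos : ∀ᶠ i in l, 0 < ρ i := (tendsto_nhdsWithin_iff.1 hρ).2
  have hle : ∀ᶠ i in l, ρ i ≤ 1 := hρ0.eventually_le_const zero_lt_one
  set B := 4 * C + 2 * C ^ 2 with hB
  rw [setIntegral_congr_fun measurableSet_polarRange fun q hq =>
    (integral_limitDefect hV₀ hC₀ hq).symm]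
  have key : Tendsto (fun i => ∫ q in polarRange, ∫ z, polarDefect (ρ i) (V i) (q, z)) l
      (𝓝 (∫ q in polarRange, ∫ z, limitDefect V₀ q z)) := by
    refine tendsto_integral_filter_of_dominated_convergence (fun _ => ∫ z, defectBound B z)
      ?_ ?_ ?_ ?_
    · filter_upwards [hV] with i hi
      have := (measurable_polarDefect (ρ i) hi).stronglyMeasurable
      exact (StronglyMeasurable.integral_prod_right
        (f := fun q z => polarDefect (ρ i) (V i) (q, z)) this).aestronglyMeasurable
    · filter_upwards [hpos, hle, hC] with i h1 h2 h3
      filter_upwards [ae_restrict_mem measurableSet_polarRange] with q hq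
      refine norm_integral_le_of_norm_le (integrable_defectBound B) (ae_of_all _ fun z => ?_)
      exact abs_polarDefect_le (by rwa [abs_of_pos h1]) h3 hq z
    · exact integrableOn_const volume_polarRange_lt_top.ne
    · filter_upwards [ae_restrict_mem measurableSet_polarRange] with q hq
      refine tendsto_integral_filter_of_dominated_convergence (defectBound B) ?_ ?_
        (integrable_defectBound B) ?_
      · exact hV.mono fun i hi => ((measurable_polarDefect (ρ i) hi).comp
          measurable_prodMk_left).aestronglyMeasurable
      · filter_upwards [hpos, hle, hC] with i h1 h2 h3
        exact ae_of_all _ fun z => abs_polarDefect_le (by rwa [abs_of_pos h1]) h3 hq z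
      · have hne : ∀ a : ℝ, ∀ᵐ z : ℝ × ℝ, z.1 ≠ a := fun a =>
          Measure.quasiMeasurePreserving_fst.ae (Measure.ae_ne volume a)
        filter_upwards [hne 1, hne (-1)] with z h1 h2
        exact tendsto_polarDefect hρ0 hlim hq h1 h2
  refine key.congr' ?_
  filter_upwards [hpos, hle, hC, hV] with i h1 h2 h3 h4
  exact (defectIntegral_eq_polar h1 h2 h4 h3).symm

/-! ### The limit functional for quadratic displacements -/

/-- The quadratic map `x ↦ x₁² a + x₁ x₂ b + x₂² c`. -/
def quadMap (a b c : ℝ × ℝ) (x : ℝ × ℝ) : ℝ × ℝ :=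
  x.1 ^ 2 • a + (x.1 * x.2) • b + x.2 ^ 2 • c

theorem continuous_quadMap (a b c : ℝ × ℝ) : Continuous (quadMap a b c) := by
  unfold quadMap; fun_prop

/-- The unique minimiser of the limit of the rescaled objective functions, for the quadratic
displacement `quadMap a b c`. -/
def limitMinimiser (a b c : ℝ × ℝ) : ℝ × ℝ :=
  ((a.1 + 3 * c.1 - b.2) / 12, (3 * a.2 + c.2 - b.1) / 12)

/-- The limit of the rescaled objective functions. -/
def limitObjective (V : ℝ × ℝ → ℝ × ℝ) : ℝ :=
  ∫ q in polarRange, ∫ t in Set.Ioo (-1 : ℝ) 1, limitSlope V q t ^ 2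

/-- The normal component of `quadMap a b c` on the unit circle with respect to the direction of
the position vector. -/
def quadNormal (a b c : ℝ × ℝ) (θ : ℝ) : ℝ :=
  cross (Real.cos θ, Real.sin θ) (quadMap a b c (Real.cos θ, Real.sin θ))

/-- The normal component of the constant vector `n` on the unit circle. -/
def constNormal (n : ℝ × ℝ) (θ : ℝ) : ℝ := cross n (Real.cos θ, Real.sin θ)

/-- Both points are multiples `r` and `t` of the same unit vector, so homogeneity of degree two
leaves a single angular function for the quadratic part and one for `n`. -/
theorem limitSlope_quadMap_sub (a b c n q : ℝ × ℝ) (t : ℝ) :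
    limitSlope (fun x => quadMap a b c x - n) q t
      = (t - q.1) * (q.1 * t * quadNormal a b c q.2 - constNormal n q.2) := by
  simp only [limitSlope, slope, cross, polar, quadNormal, constNormal, quadMap, Prod.fst_add,
    Prod.snd_add, Prod.fst_sub, Prod.snd_sub, Prod.smul_fst, Prod.smul_snd, smul_eq_mul]
  ring

theorem integral_sq_mul_sq (r P l : ℝ) :
    ∫ t in Set.Ioo (-1 : ℝ) 1, ((t - r) * (r * t * P - l)) ^ 2
      = (2 / 5 * r ^ 2 + 2 / 3 * r ^ 4) * P ^ 2 + (8 / 3 * r ^ 2) * (P * l)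
        + (2 / 3 + 2 * r ^ 2) * l ^ 2 := by
  rw [← integral_Ioc_eq_integral_Ioo, ← intervalIntegral.integral_of_le (by norm_num)]
  -- An antiderivative obtained by expanding the square in powers of `t`.
  have hderiv : ∀ t : ℝ, HasDerivAt (fun t : ℝ => r ^ 2 * P ^ 2 * (t ^ 5 / 5)
      - (2 * r * P * l + 2 * r ^ 3 * P ^ 2) * (t ^ 4 / 4)
      + (l ^ 2 + 4 * r ^ 2 * P * l + r ^ 4 * P ^ 2) * (t ^ 3 / 3)
      - (2 * r * l ^ 2 + 2 * r ^ 3 * P * l) * (t ^ 2 / 2) + r ^ 2 * l ^ 2 * t)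
      (((t - r) * (r * t * P - l)) ^ 2) t := by
    intro t
    have hp : ∀ n : ℕ, HasDerivAt (fun t : ℝ => t ^ (n + 1) / ((n : ℝ) + 1)) (t ^ n) t := by
      intro n
      have hn : (n : ℝ) + 1 ≠ 0 := by positivity
      refine ((hasDerivAt_pow (n + 1) t).div_const ((n : ℝ) + 1)).congr_deriv ?_
      push_cast
      field_simp
    have h5 := hp 4
    have h4 := hp 3
    have h3 := hp 2
    have h2 := hp 1
    norm_num at h5 h4 h3 h2
    exact (((((h5.const_mul (r ^ 2 * P ^ 2)).sub
      (h4.const_mul (2 * r * P * l + 2 * r ^ 3 * P ^ 2))).add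
      (h3.const_mul (l ^ 2 + 4 * r ^ 2 * P * l + r ^ 4 * P ^ 2))).sub
      (h2.const_mul (2 * r * l ^ 2 + 2 * r ^ 3 * P * l))).add
      ((hasDerivAt_id t).const_mul (r ^ 2 * l ^ 2))).congr_deriv (by ring)
  rw [intervalIntegral.integral_eq_sub_of_hasDerivAt (fun t _ => hderiv t)
    (Continuous.intervalIntegrable (by fun_prop) _ _)]
  ring

theorem setIntegral_polarRange_mul (f g : ℝ → ℝ) :
    ∫ q in polarRange, f q.1 * g q.2
      = (∫ r in (0 : ℝ)..1, f r) * ∫ θ in (-Real.pi)..Real.pi, g θ := by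
  rw [polarRange, Measure.volume_eq_prod, setIntegral_prod_mul, ← integral_Ioc_eq_integral_Ioo,
    ← intervalIntegral.integral_of_le zero_le_one,
    ← intervalIntegral.integral_of_le (by linarith [Real.pi_pos])]

theorem integrableOn_polarRange {f : ℝ × ℝ → ℝ} (hf : Continuous f) :
    IntegrableOn f polarRange :=
  (hf.continuousOn.integrableOn_compact (isCompact_Icc.prod isCompact_Icc)).mono_set
    (Set.prod_mono Set.Ioc_subset_Icc_self Set.Ioo_subset_Icc_self)

theorem continuous_quadNormal (a b c : ℝ × ℝ) : Continuous (quadNormal a b c) := by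
  unfold quadNormal cross quadMap; fun_prop

theorem continuous_constNormal (n : ℝ × ℝ) : Continuous (constNormal n) := by
  unfold constNormal cross; fun_prop

/-- The integrand is a sum of products of a function of the radius and a function of the angle; the
coefficients are the radial integrals over `[0, 1]`. -/
theorem limitObjective_eq_integral (a b c n : ℝ × ℝ) :
    limitObjective (fun x => quadMap a b c x - n)
      = 4 / 15 * (∫ θ in (-Real.pi)..Real.pi, quadNormal a b c θ ^ 2)
        + 8 / 9 * (∫ θ in (-Real.pi)..Real.pi, quadNormal a b c θ * constNormal n θ)
        + 4 / 3 * ∫ θ in (-Real.pi)..Real.pi, constNormal n θ ^ 2 := by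
  have hP := continuous_quadNormal a b c
  have hl := continuous_constNormal n
  simp only [limitObjective, limitSlope_quadMap_sub, integral_sq_mul_sq]
  rw [integral_add (integrableOn_polarRange (by fun_prop)) (integrableOn_polarRange (by fun_prop)),
    integral_add (integrableOn_polarRange (by fun_prop)) (integrableOn_polarRange (by fun_prop)),
    setIntegral_polarRange_mul (fun r => 2 / 5 * r ^ 2 + 2 / 3 * r ^ 4)
      (fun θ => quadNormal a b c θ ^ 2),
    setIntegral_polarRange_mul (fun r => 8 / 3 * r ^ 2)
      (fun θ => quadNormal a b c θ * constNormal n θ),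
    setIntegral_polarRange_mul (fun r => 2 / 3 + 2 * r ^ 2) (fun θ => constNormal n θ ^ 2)]
  have i1 : ∫ r in (0 : ℝ)..1, (2 / 5 * r ^ 2 + 2 / 3 * r ^ 4) = 4 / 15 := by
    rw [intervalIntegral.integral_add (Continuous.intervalIntegrable (by fun_prop) _ _)
      (Continuous.intervalIntegrable (by fun_prop) _ _)]
    simp only [intervalIntegral.integral_const_mul, integral_pow]
    norm_num
  have i2 : ∫ r in (0 : ℝ)..1, 8 / 3 * r ^ 2 = 8 / 9 := by
    simp only [intervalIntegral.integral_const_mul, integral_pow]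
    norm_num
  have i3 : ∫ r in (0 : ℝ)..1, (2 / 3 + 2 * r ^ 2) = 4 / 3 := by
    rw [intervalIntegral.integral_add (Continuous.intervalIntegrable (by fun_prop) _ _)
      (Continuous.intervalIntegrable (by fun_prop) _ _)]
    simp only [intervalIntegral.integral_const_mul, integral_pow, intervalIntegral.integral_const]
    norm_num
  rw [i1, i2, i3]

theorem integral_eq_zero_of_odd {f : ℝ → ℝ} (hf : ∀ x, f (-x) = -f x) (a : ℝ) :
    ∫ x in (-a)..a, f x = 0 := by
  have h := intervalIntegral.integral_comp_neg (a := -a) (b := a) f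
  simp only [hf, neg_neg, intervalIntegral.integral_neg] at h
  linarith

theorem integral_cos_sq_period : ∫ θ in (-Real.pi)..Real.pi, Real.cos θ ^ 2 = Real.pi := by
  rw [integral_cos_sq]; simp

theorem integral_sin_sq_period : ∫ θ in (-Real.pi)..Real.pi, Real.sin θ ^ 2 = Real.pi := by
  rw [integral_sin_sq]; simp

theorem integral_cos_sq_mul_sin_sq_period :
    ∫ θ in (-Real.pi)..Real.pi, Real.cos θ ^ 2 * Real.sin θ ^ 2 = Real.pi / 4 := by
  have h := integral_sin_sq_mul_cos_sq (a := -Real.pi) (b := Real.pi)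
  have s1 : Real.sin (4 * Real.pi) = 0 := by exact_mod_cast Real.sin_nat_mul_pi 4
  have s2 : Real.sin (4 * -Real.pi) = 0 := by rw [mul_neg, Real.sin_neg, s1, neg_zero]
  rw [s1, s2] at h
  simp only [mul_comm (Real.cos _ ^ 2)]
  rw [h]; ring

/-- A trigonometric polynomial which is homogeneous of degree two is integrated over a period. -/
theorem integral_quadratic_trig (p q r : ℝ) :
    ∫ θ in (-Real.pi)..Real.pi, (p * Real.cos θ ^ 2 + q * Real.sin θ ^ 2
      + r * (Real.cos θ * Real.sin θ)) = (p + q) * Real.pi := by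
  rw [intervalIntegral.integral_add (Continuous.intervalIntegrable (by fun_prop) _ _)
      (Continuous.intervalIntegrable (by fun_prop) _ _),
    intervalIntegral.integral_add (Continuous.intervalIntegrable (by fun_prop) _ _)
      (Continuous.intervalIntegrable (by fun_prop) _ _)]
  simp only [intervalIntegral.integral_const_mul, integral_cos_sq_period, integral_sin_sq_period]
  rw [integral_eq_zero_of_odd (fun x => by simp)]
  ring

theorem integral_constNormal_sq (n : ℝ × ℝ) :
    ∫ θ in (-Real.pi)..Real.pi, constNormal n θ ^ 2 = (n.1 ^ 2 + n.2 ^ 2) * Real.pi := by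
  have e : ∀ θ, constNormal n θ ^ 2 = n.2 ^ 2 * Real.cos θ ^ 2 + n.1 ^ 2 * Real.sin θ ^ 2
      + (-2 * n.1 * n.2) * (Real.cos θ * Real.sin θ) := by
    intro θ; simp only [constNormal, cross]; ring
  simp only [e]
  rw [integral_quadratic_trig]
  ring

theorem integral_quadNormal_mul_constNormal (a b c n : ℝ × ℝ) :
    ∫ θ in (-Real.pi)..Real.pi, quadNormal a b c θ * constNormal n θ
      = -3 * Real.pi * (n.1 * (limitMinimiser a b c).1 + n.2 * (limitMinimiser a b c).2) := by
  set k := n.1 * (b.2 - a.1) + n.2 * (b.1 - c.2) + n.1 * c.1 + n.2 * a.2 with hk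
  -- The quartic trigonometric polynomial is reduced with `cos² + sin² = 1`; the last summand is odd
  -- in `θ` and integrates to zero.
  have e : ∀ θ, quadNormal a b c θ * constNormal n θ
      = (-(n.2 * a.2) * Real.cos θ ^ 2 + -(n.1 * c.1) * Real.sin θ ^ 2
        + 0 * (Real.cos θ * Real.sin θ)) + k * (Real.cos θ ^ 2 * Real.sin θ ^ 2)
        + (Real.cos θ * Real.sin θ)
        * ((n.1 * a.2 + n.2 * (a.1 - b.2)) * Real.cos θ ^ 2
          + (n.1 * (c.2 - b.1) + n.2 * c.1) * Real.sin θ ^ 2) := by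
    intro θ
    simp only [quadNormal, constNormal, cross, quadMap, Prod.fst_add,
      Prod.snd_add, Prod.smul_fst, Prod.smul_snd, smul_eq_mul, hk]
    linear_combination (-(n.2 * a.2) * Real.cos θ ^ 2 - (n.1 * c.1) * Real.sin θ ^ 2)
      * Real.cos_sq_add_sin_sq θ
  simp only [e]
  rw [intervalIntegral.integral_add (Continuous.intervalIntegrable (by fun_prop) _ _)
      (Continuous.intervalIntegrable (by fun_prop) _ _),
    intervalIntegral.integral_add (Continuous.intervalIntegrable (by fun_prop) _ _)
      (Continuous.intervalIntegrable (by fun_prop) _ _),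
    integral_quadratic_trig, intervalIntegral.integral_const_mul,
    integral_cos_sq_mul_sin_sq_period,
    integral_eq_zero_of_odd (fun x => by simp only [Real.cos_neg, Real.sin_neg]; ring)]
  simp only [limitMinimiser, hk]
  ring

/-- Completion of the square: the cross term is `8/9 * (-3π) ⟨n, n₀⟩ = -2 * (4/3)π ⟨n, n₀⟩`, which
matches the quadratic term `(4/3)π |n|²`. -/
theorem limitObjective_quadMap_sub (a b c n : ℝ × ℝ) :
    limitObjective (fun x => quadMap a b c x - n)
      = limitObjective (fun x => quadMap a b c x - limitMinimiser a b c)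
        + 4 / 3 * Real.pi * ((n.1 - (limitMinimiser a b c).1) ^ 2
          + (n.2 - (limitMinimiser a b c).2) ^ 2) := by
  simp only [limitObjective_eq_integral, integral_constNormal_sq,
    integral_quadNormal_mul_constNormal]
  ring

/-! ### Area integrals: reduction to defects, and convexity -/

/-- Twice the area of the triangle with one vertex at the origin and the others at displaced
points `z.1` and `z.2`. -/
def areaIntegrand (ρ : ℝ) (V : ℝ × ℝ → ℝ × ℝ) (z : (ℝ × ℝ) × (ℝ × ℝ)) : ℝ :=
  |cross (z.1 + ρ • V z.1) (z.2 + ρ • V z.2)|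

/-- The integral of `areaIntegrand` over all pairs of points of the disc. -/
def areaIntegral (ρ : ℝ) (V : ℝ × ℝ → ℝ × ℝ) : ℝ :=
  ∫ z, areaIntegrand ρ V z ∂(discMeasure.prod discMeasure)

theorem measurable_areaIntegrand (ρ : ℝ) {V : ℝ × ℝ → ℝ × ℝ} (hV : Measurable V) :
    Measurable (areaIntegrand ρ V) :=
  (measurable_cross (measurable_fst.add ((hV.comp measurable_fst).const_smul ρ))
    (measurable_snd.add ((hV.comp measurable_snd).const_smul ρ))).norm

theorem integrable_areaIntegrand (ρ : ℝ) {V : ℝ × ℝ → ℝ × ℝ} (hV : Measurable V) {C : ℝ}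
    (hC : ∀ x ∈ disc, ‖V x‖ ≤ C) :
    Integrable (areaIntegrand ρ V) (discMeasure.prod discMeasure) := by
  have hb : ∀ x ∈ disc, ‖x + ρ • V x‖ ≤ 1 + |ρ| * C := fun x hx => by
    refine (norm_add_le _ _).trans ?_
    rw [norm_smul, Real.norm_eq_abs]
    gcongr
    · exact norm_le_one_of_mem_disc hx
    · exact hC x hx
  refine integrable_disc_prod (C := 2 * ((1 + |ρ| * C) * (1 + |ρ| * C)))
    (measurable_areaIntegrand ρ hV) fun x hx y hy => ?_
  rw [areaIntegrand, abs_abs]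
  refine abs_cross_le.trans ?_
  have := mul_le_mul (hb x hx) (hb y hy) (norm_nonneg _) ((norm_nonneg _).trans (hb x hx))
  linarith

theorem integrable_areaIntegrand_sub (ρ : ℝ) {V : ℝ × ℝ → ℝ × ℝ} (hV : Measurable V) {C : ℝ}
    (hC : ∀ x ∈ disc, ‖V x‖ ≤ C) (n : ℝ × ℝ) :
    Integrable (areaIntegrand ρ fun x => V x - n) (discMeasure.prod discMeasure) :=
  integrable_areaIntegrand ρ (hV.sub_const n) (C := C + ‖n‖) fun x hx =>
    (norm_sub_le _ _).trans (by gcongr; exact hC x hx)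

theorem integrable_sign_cross_mul {φ : (ℝ × ℝ) × (ℝ × ℝ) → ℝ} (hφ : Measurable φ) {C : ℝ}
    (hC : ∀ x ∈ disc, ∀ y ∈ disc, |φ (x, y)| ≤ C) :
    Integrable (fun z => Real.sign (cross z.1 z.2) * φ z) (discMeasure.prod discMeasure) := by
  refine integrable_disc_prod (C := C) ((measurable_real_sign.comp
    (measurable_cross measurable_fst measurable_snd)).mul hφ) fun x hx y hy => ?_
  rw [abs_mul]
  refine (mul_le_of_le_one_left (abs_nonneg _) ?_).trans (hC x hx y hy)
  rcases Real.sign_apply_eq (cross x y) with h | h | h <;> simp [h]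

/-- The integrand is odd under `z.2 ↦ -z.2`, which preserves the measure on the disc. -/
theorem integral_sign_cross_mul_fst {φ : ℝ × ℝ → ℝ} (hφ : Measurable φ) :
    ∫ z, Real.sign (cross z.1 z.2) * φ z.1 ∂(discMeasure.prod discMeasure) = 0 := by
  have hmp := (MeasurePreserving.id discMeasure).prod measurePreserving_neg_discMeasure
  have hm : Measurable fun z : (ℝ × ℝ) × (ℝ × ℝ) => Real.sign (cross z.1 z.2) * φ z.1 :=
    (measurable_real_sign.comp (measurable_cross measurable_fst measurable_snd)).mul
      (hφ.comp measurable_fst)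
  have h := integral_map (μ := discMeasure.prod discMeasure) hmp.measurable.aemeasurable
    (f := fun z : (ℝ × ℝ) × (ℝ × ℝ) => Real.sign (cross z.1 z.2) * φ z.1)
    hm.aestronglyMeasurable
  rw [hmp.map_eq] at h
  have e : ∀ z : (ℝ × ℝ) × (ℝ × ℝ), Real.sign (cross z.1 (-z.2)) * φ z.1
      = -(Real.sign (cross z.1 z.2) * φ z.1) := fun z => by
    rw [show cross z.1 (-z.2) = -cross z.1 z.2 by simp [cross]; ring, Real.sign_neg, neg_mul]
  simp only [Prod.map_fst, Prod.map_snd, id_eq, e, integral_neg] at h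
  linarith

theorem integral_sign_cross_mul_snd {φ : ℝ × ℝ → ℝ} (hφ : Measurable φ) :
    ∫ z, Real.sign (cross z.1 z.2) * φ z.2 ∂(discMeasure.prod discMeasure) = 0 := by
  have hmp := measurePreserving_neg_discMeasure.prod (MeasurePreserving.id discMeasure)
  have hm : Measurable fun z : (ℝ × ℝ) × (ℝ × ℝ) => Real.sign (cross z.1 z.2) * φ z.2 :=
    (measurable_real_sign.comp (measurable_cross measurable_fst measurable_snd)).mul
      (hφ.comp measurable_snd)
  have h := integral_map (μ := discMeasure.prod discMeasure) hmp.measurable.aemeasurable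
    (f := fun z : (ℝ × ℝ) × (ℝ × ℝ) => Real.sign (cross z.1 z.2) * φ z.2)
    hm.aestronglyMeasurable
  rw [hmp.map_eq] at h
  have e : ∀ z : (ℝ × ℝ) × (ℝ × ℝ), Real.sign (cross (-z.1) z.2) * φ z.2
      = -(Real.sign (cross z.1 z.2) * φ z.2) := fun z => by
    rw [show cross (-z.1) z.2 = -cross z.1 z.2 by simp [cross]; ring, Real.sign_neg, neg_mul]
  simp only [Prod.map_fst, Prod.map_snd, id_eq, e, integral_neg] at h
  linarith

theorem slope_sub_const (ρ : ℝ) (V : ℝ × ℝ → ℝ × ℝ) (n x y : ℝ × ℝ) :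
    slope ρ (fun x => V x - n) x y
      = slope ρ V x y + (cross n x + ρ * cross n (V x)) - (cross n y + ρ * cross n (V y)) := by
  simp only [slope, cross, Prod.fst_sub, Prod.snd_sub]
  ring

/-- By `slope_sub_const` the shift by `n` changes the slope by a function of `x` minus the same
function of `y`; the term `cross n n` vanishes. Against the sign of `cross x y` both integrate to
zero, so only the defects feel `n` in the difference. -/
theorem areaIntegral_sub_const {ρ : ℝ} (hρ : |ρ| ≤ 1) {V : ℝ × ℝ → ℝ × ℝ} (hV : Measurable V)
    {C : ℝ} (hC : ∀ x ∈ disc, ‖V x‖ ≤ C) (n : ℝ × ℝ) :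
    areaIntegral ρ (fun x => V x - n) - areaIntegral ρ V
      = defectIntegral ρ (fun x => V x - n) - defectIntegral ρ V := by
  have hVn : Measurable fun x => V x - n := hV.sub_const n
  have hCn : ∀ x ∈ disc, ‖V x - n‖ ≤ C + ‖n‖ := fun x hx =>
    (norm_sub_le _ _).trans (by gcongr; exact hC x hx)
  set φ : ℝ × ℝ → ℝ := fun x => ρ * (cross n x + ρ * cross n (V x)) with hφ
  have hφm : Measurable φ := by
    refine Measurable.const_mul ?_ ρ
    exact (measurable_cross measurable_const measurable_id).add
      ((measurable_cross measurable_const hV).const_mul ρ)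
  have hφb : ∀ x ∈ disc, |φ x| ≤ 2 * ‖n‖ + 2 * (‖n‖ * C) := fun x hx => by
    have h1 : |cross n x| ≤ 2 * ‖n‖ := abs_cross_le.trans <| by
      have := mul_le_mul_of_nonneg_left (norm_le_one_of_mem_disc hx) (norm_nonneg n)
      linarith
    have h2 : |cross n (V x)| ≤ 2 * (‖n‖ * C) := abs_cross_le.trans <| by
      have := mul_le_mul_of_nonneg_left (hC x hx) (norm_nonneg n)
      linarith
    rw [hφ, abs_mul]
    refine (mul_le_of_le_one_left (abs_nonneg _) hρ).trans ?_
    refine (abs_add_le _ _).trans (add_le_add h1 ?_)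
    rw [abs_mul]
    exact (mul_le_of_le_one_left (abs_nonneg _) hρ).trans h2
  have i1 := integrable_sign_cross_mul (φ := fun z => φ z.1) (hφm.comp measurable_fst)
    fun x hx y _ => hφb x hx
  have i2 := integrable_sign_cross_mul (φ := fun z => φ z.2) (hφm.comp measurable_snd)
    fun x _ y hy => hφb y hy
  unfold areaIntegral defectIntegral
  rw [← integral_sub (integrable_areaIntegrand ρ hVn hCn) (integrable_areaIntegrand ρ hV hC),
    ← integral_sub (integrable_defect ρ hVn hρ hCn) (integrable_defect ρ hV hρ hC)]
  have i3 : Integrable (fun z : (ℝ × ℝ) × (ℝ × ℝ) =>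
      signDefect (cross z.1 z.2) (ρ * slope ρ (fun x => V x - n) z.1 z.2)
        - signDefect (cross z.1 z.2) (ρ * slope ρ V z.1 z.2)) (discMeasure.prod discMeasure) :=
    (integrable_defect ρ hVn hρ hCn).sub (integrable_defect ρ hV hρ hC)
  have i4 : Integrable (fun z : (ℝ × ℝ) × (ℝ × ℝ) =>
      Real.sign (cross z.1 z.2) * φ z.1 - Real.sign (cross z.1 z.2) * φ z.2)
      (discMeasure.prod discMeasure) := i1.sub i2
  have h0 : ∫ z, (Real.sign (cross z.1 z.2) * φ z.1 - Real.sign (cross z.1 z.2) * φ z.2)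
      ∂(discMeasure.prod discMeasure) = 0 := by
    rw [integral_sub i1 i2, integral_sign_cross_mul_fst hφm, integral_sign_cross_mul_snd hφm,
      sub_zero]
  have h5 := integral_add i3 i4
  rw [h0, add_zero] at h5
  rw [← h5]
  congr 1; ext z
  simp only [areaIntegrand, cross_displaced ρ V, cross_displaced ρ (fun x => V x - n), signDefect,
    slope_sub_const, hφ]
  ring

/-- The limit is taken jointly in `ρ → 0` and `n → n₀`, as needed for uniformity on compact sets of
`n`. -/
theorem tendsto_areaIntegral_diff {W : ℝ → ℝ × ℝ → ℝ × ℝ} {W₀ : ℝ × ℝ → ℝ × ℝ}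
    (hW : ∀ᶠ ρ in 𝓝[>] 0, Measurable (W ρ)) (hW₀ : Continuous W₀)
    (hlim : TendstoUniformlyOn W W₀ (𝓝[>] 0) disc) (n₀ : ℝ × ℝ) :
    Tendsto (fun i : ℝ × (ℝ × ℝ) => (i.1 ^ 2)⁻¹ *
        (areaIntegral i.1 (fun x => W i.1 x - i.2) - areaIntegral i.1 (W i.1)))
      (𝓝[>] 0 ×ˢ 𝓝 n₀)
      (𝓝 (limitObjective (fun x => W₀ x - n₀) - limitObjective W₀)) := by
  obtain ⟨C₀, hC₀⟩ := isCompact_disc.exists_bound_of_continuousOn hW₀.continuousOn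
  have hCW : ∀ᶠ ρ in 𝓝[>] (0 : ℝ), ∀ x ∈ disc, ‖W ρ x‖ ≤ C₀ + 1 := by
    filter_upwards [Metric.tendstoUniformlyOn_iff.1 hlim 1 one_pos] with ρ h x hx
    have h1 := h x hx
    rw [dist_comm, dist_eq_norm] at h1
    have h2 := norm_add_le (W ρ x - W₀ x) (W₀ x)
    rw [sub_add_cancel] at h2
    linarith [hC₀ x hx]
  set l : Filter (ℝ × (ℝ × ℝ)) := 𝓝[>] (0 : ℝ) ×ˢ 𝓝 n₀ with hl
  have hfst : Tendsto (fun i : ℝ × (ℝ × ℝ) => i.1) l (𝓝[>] 0) := tendsto_fst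
  have hsnd : Tendsto (fun i : ℝ × (ℝ × ℝ) => i.2) l (𝓝 n₀) := tendsto_snd
  have hun : TendstoUniformlyOn (fun i : ℝ × (ℝ × ℝ) => W i.1) W₀ l disc := fun u hu =>
    hfst.eventually (hlim u hu)
  have hcomp : ∀ x ∈ disc, ∀ y : ℝ × (ℝ × ℝ) → ℝ × ℝ, Tendsto y l (𝓝[disc] x) →
      Tendsto (fun i => W i.1 (y i)) l (𝓝 (W₀ x)) := fun x _ y hy =>
    hun.tendsto_comp hW₀.continuousWithinAt hy
  have hsn : ∀ᶠ i in l, ‖i.2‖ ≤ ‖n₀‖ + 1 :=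
    hsnd.norm.eventually_le_const (lt_add_one _)
  have t1 := tendsto_defectIntegral (l := l) hfst (V := fun i x => W i.1 x - i.2)
    (V₀ := fun x => W₀ x - n₀) (C := (C₀ + 1) + (‖n₀‖ + 1))
    ((hfst.eventually hW).mono fun i h => h.sub_const i.2)
    (hW₀.measurable.sub_const n₀)
    (by
      filter_upwards [hfst.eventually hCW, hsn] with i h1 h2 x hx
      exact (norm_sub_le _ _).trans (add_le_add (h1 x hx) h2))
    (fun x hx => (norm_sub_le _ _).trans (add_le_add (by linarith [hC₀ x hx]) (by linarith)))
    (fun x hx y hy => (hcomp x hx y hy).sub hsnd)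
  have t2 := tendsto_defectIntegral (l := l) hfst (V := fun i => W i.1) (V₀ := W₀) (C := C₀ + 1)
    (hfst.eventually hW) hW₀.measurable (hfst.eventually hCW)
    (fun x hx => by linarith [hC₀ x hx]) hcomp
  refine (t1.sub t2).congr' ?_
  have hpos : ∀ᶠ i in l, 0 < i.1 := (tendsto_nhdsWithin_iff.1 hfst).2
  have hle : ∀ᶠ i in l, i.1 ≤ 1 :=
    (tendsto_nhds_of_tendsto_nhdsWithin hfst).eventually_le_const zero_lt_one
  filter_upwards [hpos, hle, hfst.eventually hCW, hfst.eventually hW] with i h1 h2 h3 h4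
  rw [areaIntegral_sub_const (by rwa [abs_of_pos h1]) h4 h3, mul_sub]

/-- The cross product is affine in the shift since its quadratic part `cross n n` is zero. Convexity
of the area in the shift follows. -/
theorem cross_displaced_sub_combo (ρ : ℝ) (V : ℝ × ℝ → ℝ × ℝ) (x y n₁ n₂ : ℝ × ℝ) {s t : ℝ}
    (hst : s + t = 1) :
    cross (x + ρ • (V x - (s • n₁ + t • n₂))) (y + ρ • (V y - (s • n₁ + t • n₂)))
      = s * cross (x + ρ • (V x - n₁)) (y + ρ • (V y - n₁))
        + t * cross (x + ρ • (V x - n₂)) (y + ρ • (V y - n₂)) := by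
  obtain rfl : t = 1 - s := by linarith
  simp only [cross, Prod.fst_add, Prod.snd_add, Prod.smul_fst, Prod.smul_snd, smul_eq_mul,
    Prod.fst_sub, Prod.snd_sub]
  ring

theorem areaIntegrand_sub_combo_le (ρ : ℝ) (V : ℝ × ℝ → ℝ × ℝ) (z : (ℝ × ℝ) × (ℝ × ℝ))
    (n₁ n₂ : ℝ × ℝ) {s t : ℝ} (hs : 0 ≤ s) (ht : 0 ≤ t) (hst : s + t = 1) :
    areaIntegrand ρ (fun x => V x - (s • n₁ + t • n₂)) z
      ≤ s * areaIntegrand ρ (fun x => V x - n₁) z + t * areaIntegrand ρ (fun x => V x - n₂) z := by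
  unfold areaIntegrand
  rw [cross_displaced_sub_combo ρ V z.1 z.2 n₁ n₂ hst]
  refine (abs_add_le _ _).trans (le_of_eq ?_)
  rw [abs_mul, abs_mul, abs_of_nonneg hs, abs_of_nonneg ht]

theorem convexOn_areaIntegral (ρ : ℝ) {V : ℝ × ℝ → ℝ × ℝ} (hV : Measurable V)
    {C : ℝ} (hC : ∀ x ∈ disc, ‖V x‖ ≤ C) :
    ConvexOn ℝ Set.univ fun n : ℝ × ℝ => areaIntegral ρ (fun x => V x - n) := by
  have hint := integrable_areaIntegrand_sub ρ hV hC
  refine ⟨convex_univ, fun n₁ _ n₂ _ s t hs ht hst => ?_⟩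
  have i1 := (hint n₁).const_mul s
  have i2 := (hint n₂).const_mul t
  simp only [areaIntegral, smul_eq_mul]
  rw [← integral_const_mul, ← integral_const_mul, ← integral_add i1 i2]
  exact integral_mono (hint _) (i1.add i2) fun z =>
    areaIntegrand_sub_combo_le ρ V z n₁ n₂ hs ht hst

/-! ### Existence, convergence and uniqueness of minimisers -/

/-- Minimisers of convex functions which converge continuously to a function with a strict global
minimum exist and converge to the minimiser of the limit. -/
theorem eventually_minimisers_near {E ι : Type*} [NormedAddCommGroup E] [NormedSpace ℝ E]
    [FiniteDimensional ℝ E] {l : Filter ι} {G : ι → E → ℝ} {L : E → ℝ} {n₀ : E}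
    (hG : ∀ᶠ i in l, ConvexOn ℝ Set.univ (G i))
    (hlim : ∀ n, Tendsto (fun i : ι × E => G i.1 i.2) (l ×ˢ 𝓝 n) (𝓝 (L n)))
    (hL : ∀ n, n ≠ n₀ → L n₀ < L n) {ε : ℝ} (hε : 0 < ε) :
    ∀ᶠ i in l, (∃ n, ∀ n', G i n ≤ G i n') ∧
      ∀ n, (∀ n', G i n ≤ G i n') → dist n n₀ < ε := by
  have : ProperSpace E := FiniteDimensional.proper ℝ E
  have hn₀ : Tendsto (fun i => G i n₀) l (𝓝 (L n₀)) :=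
    (hlim n₀).comp (tendsto_id.prodMk tendsto_const_nhds)
  -- Joint convergence and compactness of the sphere give the strict inequality at all its points
  -- simultaneously.
  have hs : ∀ᶠ i in l, ∀ n ∈ Metric.sphere n₀ ε, G i n₀ < G i n := by
    have h1 : {z : ι × E | G z.1 n₀ < G z.1 z.2} ∈ l ×ˢ 𝓝ˢ (Metric.sphere n₀ ε) := by
      refine (isCompact_sphere n₀ ε).mem_prod_nhdsSet_of_forall fun n hn => ?_
      have hne : n ≠ n₀ := Metric.ne_of_mem_sphere hn hε.ne'
      exact (hn₀.comp tendsto_fst).eventually_lt (hlim n) (hL n hne)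
    obtain ⟨t, ht, v, hv, hsub⟩ := mem_prod_iff.1 h1
    filter_upwards [ht] with i hi n hn
    exact hsub (Set.mk_mem_prod hi (subset_of_mem_nhdsSet hv hn))
  filter_upwards [hs, hG] with i hi hconv
  -- The segment from `n₀` to a point outside crosses the sphere, where the value already exceeds
  -- that at `n₀`; convexity then forbids a return to a lower value.
  have hout : ∀ n, ε ≤ dist n n₀ → G i n₀ < G i n := by
    intro n hn
    by_contra! hle
    have hd : 0 < dist n n₀ := hε.trans_le hn
    set s := ε / dist n n₀ with hs
    have hs0 : 0 ≤ s := by positivity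
    have hs1 : s ≤ 1 := (div_le_one hd).2 hn
    have hm : (1 - s) • n₀ + s • n ∈ Metric.sphere n₀ ε := by
      rw [mem_sphere_iff_norm, show (1 - s) • n₀ + s • n - n₀ = s • (n - n₀) by module,
        norm_smul, Real.norm_of_nonneg hs0, ← dist_eq_norm, hs, div_mul_cancel₀ _ hd.ne']
    have h1 := hi _ hm
    have h2 := hconv.2 (Set.mem_univ n₀) (Set.mem_univ n) (sub_nonneg.2 hs1) hs0 (by ring)
    simp only [smul_eq_mul] at h2
    nlinarith
  constructor
  · have hc : Continuous (G i) := hconv.locallyLipschitz.continuous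
    obtain ⟨n, hn, hmin⟩ := (isCompact_closedBall n₀ ε).exists_isMinOn
      ⟨n₀, Metric.mem_closedBall_self hε.le⟩ hc.continuousOn
    refine ⟨n, fun n' => ?_⟩
    by_cases h : n' ∈ Metric.closedBall n₀ ε
    · exact hmin h
    · exact (hmin (Metric.mem_closedBall_self hε.le)).trans
        (hout n' (not_le.1 h).le).le
  · intro n hn
    by_contra! h
    exact absurd (hn n₀) (not_le.2 (hout n h))

/-- The open unit disc, as a subset of `ℝ × ℝ`. -/
def openDisc : Set (ℝ × ℝ) := {x | x.1 ^ 2 + x.2 ^ 2 < 1}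

theorem isOpen_openDisc : IsOpen openDisc := isOpen_lt (by fun_prop) continuous_const

theorem openDisc_subset_disc : openDisc ⊆ disc := fun x hx => by
  have h : x.1 ^ 2 + x.2 ^ 2 < 1 := hx
  exact h.le

/-- Two minimisers would force equality in the convexity inequality at their midpoint for almost
every pair. Equality fails for a pair whose displaced points lie opposite each other about the
midpoint, off the line joining the minimisers: the triangle degenerates at the midpoint but not at
`n₁`. By continuity it also fails near this pair. -/
theorem minimiser_areaIntegral_unique {ρ κ : ℝ} (hρ : 0 < ρ) (hκ : 0 < κ)
    {V : ℝ × ℝ → ℝ × ℝ} (hV : Measurable V) {C : ℝ} (hC : ∀ x ∈ disc, ‖V x‖ ≤ C)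
    (hcont : ContinuousOn V disc)
    (hsurj : ∀ y : ℝ × ℝ, ‖y‖ ≤ κ → ∃ x ∈ openDisc, x + ρ • V x = y)
    {n₁ n₂ : ℝ × ℝ} (h₁ : ρ * ‖n₁‖ ≤ κ / 2) (h₂ : ρ * ‖n₂‖ ≤ κ / 2)
    (hm₁ : ∀ n, areaIntegral ρ (fun x => V x - n₁) ≤ areaIntegral ρ (fun x => V x - n))
    (hm₂ : ∀ n, areaIntegral ρ (fun x => V x - n₂) ≤ areaIntegral ρ (fun x => V x - n)) :
    n₁ = n₂ := by
  by_contra hne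
  have hint := integrable_areaIntegrand_sub ρ hV hC
  obtain ⟨m, hm⟩ : ∃ m, m = (1 / 2 : ℝ) • n₁ + (1 / 2 : ℝ) • n₂ := ⟨_, rfl⟩
  obtain ⟨g, hg⟩ : ∃ g : (ℝ × ℝ) × (ℝ × ℝ) → ℝ, g = fun z =>
      (1 / 2 * areaIntegrand ρ (fun x => V x - n₁) z + 1 / 2 * areaIntegrand ρ (fun x => V x - n₂) z)
        - areaIntegrand ρ (fun x => V x - m) z := ⟨_, rfl⟩
  have i1 : Integrable (fun z => 1 / 2 * areaIntegrand ρ (fun x => V x - n₁) z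
      + 1 / 2 * areaIntegrand ρ (fun x => V x - n₂) z) (discMeasure.prod discMeasure) :=
    ((hint n₁).const_mul (1 / 2)).add ((hint n₂).const_mul (1 / 2))
  have hgint : Integrable g (discMeasure.prod discMeasure) := hg ▸ i1.sub (hint m)
  have hg0 : 0 ≤ g := fun z => by
    rw [hg, Pi.zero_apply, sub_nonneg, hm]
    exact areaIntegrand_sub_combo_le ρ V z n₁ n₂ (by norm_num) (by norm_num) (by norm_num)
  have hgle : ∫ z, g z ∂(discMeasure.prod discMeasure) ≤ 0 := by
    simp only [hg]
    rw [integral_sub i1 (hint m), integral_add ((hint n₁).const_mul _) ((hint n₂).const_mul _),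
      integral_const_mul, integral_const_mul]
    have e1 := hm₁ m
    have e2 := hm₂ m
    simp only [areaIntegral] at e1 e2
    linarith
  refine absurd hgle (not_le.2 ?_)
  rw [integral_pos_iff_support_of_nonneg hg0 hgint]
  obtain ⟨d, hd⟩ : ∃ d, d = n₂ - n₁ := ⟨_, rfl⟩
  have hd0 : d ≠ 0 := hd ▸ sub_ne_zero.2 (Ne.symm hne)
  -- The difference `d` rotated by a right angle, so that `cross v d = -|d|²` is nonzero.
  obtain ⟨v, hv⟩ : ∃ v : ℝ × ℝ, v = (-d.2, d.1) := ⟨_, rfl⟩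
  have hvd : cross v d ≠ 0 := by
    intro h0
    simp only [cross, hv] at h0
    apply hd0
    have h1 : d.1 = 0 := by nlinarith [sq_nonneg d.1, sq_nonneg d.2]
    have h2 : d.2 = 0 := by nlinarith [sq_nonneg d.1, sq_nonneg d.2]
    exact Prod.ext h1 h2
  have hv0 : 0 < ‖v‖ := by
    rw [norm_pos_iff]; rintro h0; apply hvd; rw [h0]; simp [cross]
  -- Half of the radius `κ` is spent on `η • v` and half on `ρ • m`, so both target points are
  -- attained.
  obtain ⟨η, hη⟩ : ∃ η, η = κ / 2 / ‖v‖ := ⟨_, rfl⟩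
  have hη0 : 0 < η := by rw [hη]; positivity
  have hηv : ‖η • v‖ = κ / 2 := by
    rw [norm_smul, Real.norm_of_nonneg hη0.le, hη, div_mul_cancel₀ _ hv0.ne']
  have hmn : ‖ρ • m‖ ≤ κ / 2 := by
    rw [norm_smul, Real.norm_of_nonneg hρ.le]
    have : ‖m‖ ≤ 1 / 2 * ‖n₁‖ + 1 / 2 * ‖n₂‖ := by
      rw [hm]
      refine (norm_add_le _ _).trans (le_of_eq ?_)
      rw [norm_smul, norm_smul, Real.norm_of_nonneg (by norm_num)]
    nlinarith
  obtain ⟨x, hx, hfx⟩ := hsurj (ρ • m + η • v) ((norm_add_le _ _).trans (by linarith))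
  obtain ⟨y, hy, hfy⟩ := hsurj (ρ • m - η • v) ((norm_sub_le _ _).trans (by linarith))
  have hgpos : 0 < g (x, y) := by
    have ex : ∀ n, x + ρ • (V x - n) = ρ • (m - n) + η • v := fun n => by
      rw [smul_sub, ← add_sub_assoc, hfx, smul_sub]; abel
    have ey : ∀ n, y + ρ • (V y - n) = ρ • (m - n) - η • v := fun n => by
      rw [smul_sub, ← add_sub_assoc, hfy, smul_sub]; abel
    have m1 : m - n₁ = (1 / 2 : ℝ) • d := by rw [hm, hd]; module
    have m2 : m - n₂ = (-(1 / 2) : ℝ) • d := by rw [hm, hd]; module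
    simp only [hg, areaIntegrand, ex, ey, sub_self, m1, m2]
    have c0 : cross (ρ • (0 : ℝ × ℝ) + η • v) (ρ • (0 : ℝ × ℝ) - η • v) = 0 := by
      simp [cross]; ring
    have c1 : cross (ρ • (1 / 2 : ℝ) • d + η • v) (ρ • (1 / 2 : ℝ) • d - η • v)
        = ρ * η * cross v d := by
      simp only [cross, Prod.fst_add, Prod.snd_add, Prod.smul_fst, Prod.smul_snd, smul_eq_mul,
        Prod.fst_sub, Prod.snd_sub]
      ring
    rw [c0, c1, abs_zero, sub_zero]
    have : 0 < |ρ * η * cross v d| := abs_pos.2 (by positivity)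
    have := abs_nonneg (cross (ρ • (-(1 / 2) : ℝ) • d + η • v) (ρ • (-(1 / 2) : ℝ) • d - η • v))
    linarith
  set U : Set ((ℝ × ℝ) × (ℝ × ℝ)) := openDisc ×ˢ openDisc with hU
  have hUo : IsOpen U := isOpen_openDisc.prod isOpen_openDisc
  have hgc : ContinuousOn g U := by
    have h1 : ContinuousOn (fun z : (ℝ × ℝ) × (ℝ × ℝ) => V z.1) U :=
      hcont.comp continuousOn_fst fun z hz => openDisc_subset_disc hz.1
    have h2 : ContinuousOn (fun z : (ℝ × ℝ) × (ℝ × ℝ) => V z.2) U :=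
      hcont.comp continuousOn_snd fun z hz => openDisc_subset_disc hz.2
    have hA : ∀ n, ContinuousOn (areaIntegrand ρ fun x => V x - n) U := fun n =>
      (continuous_cross.comp_continuousOn
        ((continuousOn_fst.add ((h1.sub continuousOn_const).const_smul ρ)).prodMk
          (continuousOn_snd.add ((h2.sub continuousOn_const).const_smul ρ)))).abs
    rw [hg]
    exact ((continuousOn_const.mul (hA n₁)).add (continuousOn_const.mul (hA n₂))).sub (hA m)
  have hO : IsOpen (U ∩ g ⁻¹' Set.Ioi 0) := hgc.isOpen_inter_preimage hUo isOpen_Ioi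
  have hOpos : 0 < (volume : Measure ((ℝ × ℝ) × (ℝ × ℝ))) (U ∩ g ⁻¹' Set.Ioi 0) :=
    hO.measure_pos _ ⟨(x, y), ⟨hx, hy⟩, hgpos⟩
  rw [discMeasure, Measure.prod_restrict]
  refine hOpos.trans_le ?_
  have hsub : U ∩ g ⁻¹' Set.Ioi 0 ⊆ disc ×ˢ disc := fun z hz =>
    ⟨openDisc_subset_disc hz.1.1, openDisc_subset_disc hz.1.2⟩
  rw [← Measure.volume_eq_prod]
  refine (le_of_eq ?_).trans (measure_mono (s := U ∩ g ⁻¹' Set.Ioi 0)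
    fun z hz => (ne_of_gt hz.2 : g z ≠ 0))
  rw [Measure.restrict_apply hO.measurableSet, Set.inter_eq_self_of_subset_left hsub]

/-- `n` minimises the area integral of the displacements `V - n`. -/
def IsAreaMinimiser (ρ : ℝ) (V : ℝ × ℝ → ℝ × ℝ) (n : ℝ × ℝ) : Prop :=
  ∀ n', areaIntegral ρ (fun x => V x - n) ≤ areaIntegral ρ (fun x => V x - n')

/-- Subtracting a constant and multiplying by `(ρ ^ 2)⁻¹` does not change the minimisers, so the
convergence criterion applies to the rescaled functions. -/
theorem eventually_areaMinimiser {W : ℝ → ℝ × ℝ → ℝ × ℝ} {a b c : ℝ × ℝ} {κ : ℝ} (hκ : 0 < κ)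
    (hW : ∀ᶠ ρ in 𝓝[>] 0, Measurable (W ρ))
    (hcont : ∀ᶠ ρ in 𝓝[>] 0, ContinuousOn (W ρ) disc)
    (hlim : TendstoUniformlyOn W (quadMap a b c) (𝓝[>] 0) disc)
    (hsurj : ∀ᶠ ρ in 𝓝[>] (0 : ℝ), ∀ y : ℝ × ℝ, ‖y‖ ≤ κ → ∃ x ∈ openDisc, x + ρ • W ρ x = y)
    {ε : ℝ} (hε : 0 < ε) :
    ∀ᶠ ρ in 𝓝[>] (0 : ℝ), (∃! n, IsAreaMinimiser ρ (W ρ) n) ∧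
      ∀ n, IsAreaMinimiser ρ (W ρ) n → dist n (limitMinimiser a b c) < ε := by
  have hbound : ∀ᶠ ρ in 𝓝[>] (0 : ℝ), ∃ C, ∀ x ∈ disc, ‖W ρ x‖ ≤ C :=
    hcont.mono fun ρ h => isCompact_disc.exists_bound_of_continuousOn h
  have hpos : ∀ᶠ ρ in 𝓝[>] (0 : ℝ), 0 < ρ := eventually_mem_nhdsWithin
  have hnear : ∀ δ : ℝ, 0 < δ → ∀ᶠ ρ in 𝓝[>] (0 : ℝ), (∃ n, IsAreaMinimiser ρ (W ρ) n) ∧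
      ∀ n, IsAreaMinimiser ρ (W ρ) n → dist n (limitMinimiser a b c) < δ := by
    intro δ hδ
    have h := eventually_minimisers_near (l := 𝓝[>] (0 : ℝ)) (n₀ := limitMinimiser a b c)
      (G := fun ρ n => (ρ ^ 2)⁻¹ *
        (areaIntegral ρ (fun x => W ρ x - n) - areaIntegral ρ (W ρ)))
      (L := fun n => limitObjective (fun x => quadMap a b c x - n)
        - limitObjective (quadMap a b c)) ?_
      (fun n => tendsto_areaIntegral_diff hW (continuous_quadMap a b c) hlim n) ?_ hδ
    · filter_upwards [h, hpos] with ρ hρ h0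
      have e : ∀ n, (∀ n', (ρ ^ 2)⁻¹ *
          (areaIntegral ρ (fun x => W ρ x - n) - areaIntegral ρ (W ρ)) ≤ (ρ ^ 2)⁻¹ *
          (areaIntegral ρ (fun x => W ρ x - n') - areaIntegral ρ (W ρ)))
          ↔ IsAreaMinimiser ρ (W ρ) n := fun n => by
        refine forall_congr' fun n' => ?_
        rw [mul_le_mul_iff_right₀ (by positivity), sub_le_sub_iff_right]
      simpa only [e] using hρ
    · filter_upwards [hbound, hW] with ρ ⟨C, hC⟩ hm
      have h1 := (convexOn_areaIntegral ρ hm hC).add_const (-areaIntegral ρ (W ρ))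
      have h2 := h1.smul (c := (ρ ^ 2)⁻¹) (by positivity)
      simpa only [smul_eq_mul, Pi.add_apply, ← sub_eq_add_neg] using h2
    · intro n hn
      rw [limitObjective_quadMap_sub a b c n]
      have : 0 < (n.1 - (limitMinimiser a b c).1) ^ 2 + (n.2 - (limitMinimiser a b c).2) ^ 2 := by
        by_contra! h
        apply hn
        have h1 : n.1 - (limitMinimiser a b c).1 = 0 := by
          nlinarith [sq_nonneg (n.1 - (limitMinimiser a b c).1),
            sq_nonneg (n.2 - (limitMinimiser a b c).2)]
        have h2 : n.2 - (limitMinimiser a b c).2 = 0 := by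
          nlinarith [sq_nonneg (n.1 - (limitMinimiser a b c).1),
            sq_nonneg (n.2 - (limitMinimiser a b c).2)]
        exact Prod.ext (sub_eq_zero.1 h1) (sub_eq_zero.1 h2)
      have := mul_pos (mul_pos (by norm_num : (0 : ℝ) < 4 / 3) Real.pi_pos) this
      linarith
  -- Minimisers lie within distance 1 of the limit, so this bound places `ρ * ‖n‖` in the range
  -- required for uniqueness.
  have hR : ∀ᶠ ρ in 𝓝[>] (0 : ℝ), ρ * (‖limitMinimiser a b c‖ + 1) ≤ κ / 2 := by
    have : Tendsto (fun ρ : ℝ => ρ * (‖limitMinimiser a b c‖ + 1)) (𝓝[>] 0) (𝓝 0) := by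
      have h : Tendsto (fun ρ : ℝ => ρ * (‖limitMinimiser a b c‖ + 1)) (𝓝 0)
          (𝓝 (0 * (‖limitMinimiser a b c‖ + 1))) := tendsto_id.mul_const _
      rw [zero_mul] at h
      exact h.mono_left nhdsWithin_le_nhds
    exact this.eventually_le_const (half_pos hκ)
  filter_upwards [hnear 1 one_pos, hnear ε hε, hR, hpos, hbound, hW, hcont, hsurj] with
    ρ h1 h2 hR h0 ⟨C, hC⟩ hm hc hs
  refine ⟨?_, h2.2⟩
  obtain ⟨n, hn⟩ := h1.1
  have hsmall : ∀ n, IsAreaMinimiser ρ (W ρ) n → ρ * ‖n‖ ≤ κ / 2 := fun n hn => by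
    have hd := h1.2 n hn
    rw [dist_eq_norm] at hd
    have h3 := norm_add_le (n - limitMinimiser a b c) (limitMinimiser a b c)
    rw [sub_add_cancel] at h3
    refine le_trans ?_ hR
    gcongr
    linarith
  exact ⟨n, hn, fun n' hn' => minimiser_areaIntegral_unique h0 hκ hm hC hc hs (hsmall n' hn')
    (hsmall n hn) hn' hn⟩

/-! ### Second order Taylor expansion -/

/-- Taylor's theorem of order two for functions on a normed space. -/
theorem norm_taylor_two_le {E F : Type*} [NormedAddCommGroup E] [NormedSpace ℝ E]
    [NormedAddCommGroup F] [NormedSpace ℝ F] {u : E → F} {p : E} (hu : ContDiffAt ℝ 2 u p)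
    {ε : ℝ} (hε : 0 < ε) :
    ∃ δ > 0, ∀ h, ‖h‖ < δ → ‖u (p + h) - u p - fderiv ℝ u p h
      - (1 / 2 : ℝ) • fderiv ℝ (fderiv ℝ u) p h h‖ ≤ ε * ‖h‖ ^ 2 := by
  have hsymm : ∀ v w, fderiv ℝ (fderiv ℝ u) p v w = fderiv ℝ (fderiv ℝ u) p w v :=
    hu.isSymmSndFDerivAt (by simp)
  have hdu : DifferentiableAt ℝ (fderiv ℝ u) p :=
    (hu.fderiv_right (m := 1) (by norm_num)).differentiableAt (by norm_num)
  have h1 : ∀ᶠ q in 𝓝 p, DifferentiableAt ℝ u q :=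
    (hu.eventually (by simp)).mono fun q hq => hq.differentiableAt (by norm_num)
  have h2 := hdu.hasFDerivAt.isLittleO.bound hε
  obtain ⟨δ, hδ, hball⟩ := Metric.eventually_nhds_iff.1 (h1.and h2)
  refine ⟨δ, hδ, fun h hh => ?_⟩
  set D := fderiv ℝ (fderiv ℝ u) p with hD
  -- Mean value inequality for the remainder on the ball of radius `‖h‖`: its derivative is the
  -- first order remainder of `fderiv ℝ u`, bounded by `ε * ‖h‖`.
  have key := Convex.norm_image_sub_le_of_norm_hasFDerivWithin_le (𝕜 := ℝ) (x := (0 : E)) (y := h)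
    (f := fun h => u (p + h) - u p - fderiv ℝ u p h - (1 / 2 : ℝ) • D h h)
    (f' := fun h => fderiv ℝ u (p + h) - fderiv ℝ u p - D h) (C := ε * ‖h‖)
    (s := Metric.closedBall (0 : E) ‖h‖) ?_ ?_ (convex_closedBall _ _) (by simp) (by simp)
  · simpa [sq, mul_assoc] using key
  · intro x hx
    have hx' : dist (p + x) p < δ := by
      rw [dist_eq_norm, add_sub_cancel_left]
      exact (mem_closedBall_zero_iff.1 hx).trans_lt hh
    have d1 : HasFDerivAt (fun h => u (p + h)) (fderiv ℝ u (p + x)) x :=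
      (hasFDerivAt_comp_add_left p).2 (hball hx').1.hasFDerivAt
    have d2 : HasFDerivAt (fun h => D h h) (D x + D.flip x) x := by
      have := D.hasFDerivAt.clm_apply (hasFDerivAt_id x)
      refine this.congr_fderiv ?_
      ext v; simp
    have d3 := ((d1.sub_const (u p)).sub (fderiv ℝ u p).hasFDerivAt).sub (d2.const_smul (1 / 2 : ℝ))
    refine (d3.congr_fderiv ?_).hasFDerivWithinAt
    ext v
    simp only [sub_apply, smul_apply, add_apply, ContinuousLinearMap.flip_apply]
    rw [hsymm v x, ← two_smul ℝ (D x v), smul_smul]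
    norm_num
  · intro x hx
    have hx' : dist (p + x) p < δ := by
      rw [dist_eq_norm, add_sub_cancel_left]
      exact (mem_closedBall_zero_iff.1 hx).trans_lt hh
    have := (hball hx').2
    rw [add_sub_cancel_left] at this
    refine this.trans ?_
    gcongr
    exact mem_closedBall_zero_iff.1 hx

/-! ### Transfer between the Euclidean plane and pairs of reals -/

/-- The identification of `ℝ × ℝ` with the Euclidean plane. -/
def toPlane : (ℝ × ℝ) ≃L[ℝ] Plane :=
  (ContinuousLinearEquiv.finTwoArrow ℝ ℝ).symm.trans (EuclideanSpace.equiv (Fin 2) ℝ).symm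

theorem toPlane_zero (x : ℝ × ℝ) : toPlane x 0 = x.1 := rfl

theorem toPlane_one (x : ℝ × ℝ) : toPlane x 1 = x.2 := rfl

theorem norm_toPlane_sq (x : ℝ × ℝ) : ‖toPlane x‖ ^ 2 = x.1 ^ 2 + x.2 ^ 2 := by
  rw [EuclideanSpace.norm_sq_eq, Fin.sum_univ_two, toPlane_zero, toPlane_one]
  simp

theorem mem_disc_iff {x : ℝ × ℝ} : x ∈ disc ↔ ‖toPlane x‖ ≤ 1 := by
  rw [← sq_le_one_iff₀ (norm_nonneg _), norm_toPlane_sq]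
  rfl

theorem mem_openDisc_iff {x : ℝ × ℝ} : x ∈ openDisc ↔ ‖toPlane x‖ < 1 := by
  rw [← sq_lt_one_iff₀ (norm_nonneg _), norm_toPlane_sq]
  rfl

theorem measurePreserving_toPlane : MeasurePreserving toPlane volume volume :=
  (PiLp.volume_preserving_toLp (Fin 2)).comp (volume_preserving_finTwoArrow ℝ).symm

theorem toPlane_eq (x : ℝ × ℝ) :
    toPlane x = x.1 • EuclideanSpace.single 0 1 + x.2 • EuclideanSpace.single 1 1 := by
  ext i
  fin_cases i
  · simp [toPlane_zero]
  · simp [toPlane_one]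

/-- The linear equivalence which maps the standard basis vectors to `a` and `b`. -/
def basisEquiv (a b : Plane) (h : a 0 * b 1 - b 0 * a 1 ≠ 0) : (ℝ × ℝ) ≃L[ℝ] Plane :=
  LinearEquiv.toContinuousLinearEquiv
    { toFun := fun x => x.1 • a + x.2 • b
      map_add' := fun x y => by simp only [Prod.fst_add, Prod.snd_add]; module
      map_smul' := fun c x => by
        simp only [Prod.smul_fst, Prod.smul_snd, smul_eq_mul, RingHom.id_apply]; module
      invFun := fun m => ((m 0 * b 1 - m 1 * b 0) / (a 0 * b 1 - b 0 * a 1),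
        (a 0 * m 1 - a 1 * m 0) / (a 0 * b 1 - b 0 * a 1))
      left_inv := fun x => by
        ext
        · simp only [PiLp.add_apply, PiLp.smul_apply, smul_eq_mul]; rw [div_eq_iff h]; ring
        · simp only [PiLp.add_apply, PiLp.smul_apply, smul_eq_mul]; rw [div_eq_iff h]; ring
      right_inv := fun m => by
        ext i
        fin_cases i
        · simp only [PiLp.add_apply, PiLp.smul_apply, smul_eq_mul, Fin.zero_eta]
          rw [div_mul_eq_mul_div, div_mul_eq_mul_div, ← add_div, div_eq_iff h]; ring
        · simp only [PiLp.add_apply, PiLp.smul_apply, smul_eq_mul, Fin.mk_one]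
          rw [div_mul_eq_mul_div, div_mul_eq_mul_div, ← add_div, div_eq_iff h]; ring }

theorem basisEquiv_apply {a b : Plane} (h : a 0 * b 1 - b 0 * a 1 ≠ 0) (x : ℝ × ℝ) :
    basisEquiv a b h x = x.1 • a + x.2 • b := rfl

theorem triangleArea_basisEquiv {a b : Plane} (h : a 0 * b 1 - b 0 * a 1 ≠ 0) (o : Plane) (ρ : ℝ)
    (n x y : ℝ × ℝ) :
    triangleArea (o + ρ • basisEquiv a b h n) (o + ρ • basisEquiv a b h x)
        (o + ρ • basisEquiv a b h y)
      = ρ ^ 2 * |a 0 * b 1 - b 0 * a 1| / 2 * |cross (x - n) (y - n)| := by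
  have e : ((o + ρ • basisEquiv a b h x) 0 - (o + ρ • basisEquiv a b h n) 0)
      * ((o + ρ • basisEquiv a b h y) 1 - (o + ρ • basisEquiv a b h n) 1)
      - ((o + ρ • basisEquiv a b h x) 1 - (o + ρ • basisEquiv a b h n) 1)
      * ((o + ρ • basisEquiv a b h y) 0 - (o + ρ • basisEquiv a b h n) 0)
      = ρ ^ 2 * ((a 0 * b 1 - b 0 * a 1) * cross (x - n) (y - n)) := by
    simp only [basisEquiv_apply, PiLp.add_apply, PiLp.smul_apply, smul_eq_mul, cross,
      Prod.fst_sub, Prod.snd_sub]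
    ring
  rw [triangleArea, e, abs_mul, abs_mul, abs_of_nonneg (sq_nonneg ρ)]
  ring

/-- The uniform distribution on a disc of the plane is a multiple of the image of the Lebesgue
measure on the unit disc. -/
theorem cond_closedBall_eq (p : Plane) {ρ : ℝ} (hρ : 0 < ρ) :
    ∃ c : ENNReal, c ≠ 0 ∧ c ≠ ⊤ ∧ cond volume (Metric.closedBall p ρ)
      = c • Measure.map (fun x => p + ρ • toPlane x) discMeasure := by
  set T : ℝ × ℝ → Plane := fun x => p + ρ • toPlane x with hT
  have hTm : Measurable T :=
    ((toPlane.continuous.const_smul ρ).const_add p).measurable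
  have hmap : Measure.map T volume
      = ENNReal.ofReal |(ρ ^ Module.finrank ℝ Plane)⁻¹| • (volume : Measure Plane) := by
    have e : T = (fun x => p + x) ∘ (fun x => ρ • x) ∘ toPlane := rfl
    rw [e, ← Measure.map_map (measurable_const_add p)
      ((measurable_const_smul ρ).comp toPlane.continuous.measurable),
      ← Measure.map_map (measurable_const_smul ρ) toPlane.continuous.measurable,
      measurePreserving_toPlane.map_eq, Measure.map_addHaar_smul _ hρ.ne', Measure.map_smul,
      map_add_left_eq_self]
  have hpre : T ⁻¹' Metric.closedBall p ρ = disc := by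
    ext x
    rw [Set.mem_preimage, mem_closedBall_iff_norm, hT, add_sub_cancel_left, norm_smul,
      Real.norm_of_nonneg hρ.le, mem_disc_iff, mul_le_iff_le_one_right hρ]
  set k := ENNReal.ofReal |(ρ ^ Module.finrank ℝ Plane)⁻¹| with hk
  have hk0 : k ≠ 0 := by
    rw [hk, Ne, ENNReal.ofReal_eq_zero, not_le]; positivity
  have hkt : k ≠ ⊤ := ENNReal.ofReal_ne_top
  have hres : Measure.map T discMeasure = k • volume.restrict (Metric.closedBall p ρ) := by
    rw [discMeasure, ← hpre, ← Measure.restrict_map hTm Metric.isClosed_closedBall.measurableSet,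
      hmap, Measure.restrict_smul]
  have hv0 : volume (Metric.closedBall p ρ) ≠ 0 :=
    (Metric.measure_closedBall_pos volume p hρ).ne'
  have hvt : volume (Metric.closedBall p ρ) ≠ ⊤ := measure_closedBall_lt_top.ne
  refine ⟨(volume (Metric.closedBall p ρ))⁻¹ * k⁻¹, ?_, ?_, ?_⟩
  · exact mul_ne_zero (ENNReal.inv_ne_zero.2 hvt) (ENNReal.inv_ne_zero.2 hkt)
  · exact ENNReal.mul_ne_top (ENNReal.inv_ne_top.2 hv0) (ENNReal.inv_ne_top.2 hk0)
  · rw [hres, smul_smul, mul_assoc, ENNReal.inv_mul_cancel hk0 hkt, mul_one]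
    rfl

theorem continuous_triangleArea (m : Plane) :
    Continuous fun z : Plane × Plane => triangleArea m z.1 z.2 := by
  unfold triangleArea
  fun_prop

theorem ojaObjective_smul_map {c : ENNReal} {F : ℝ × ℝ → Plane} (hF : Measurable F) (m : Plane)
    (hint : Integrable (fun z => triangleArea m (F z.1) (F z.2)) (discMeasure.prod discMeasure)) :
    ojaObjective (c • Measure.map F discMeasure) m
      = c.toReal ^ 2 * ∫ z, triangleArea m (F z.1) (F z.2) ∂(discMeasure.prod discMeasure) := by
  have hcont := continuous_triangleArea m
  have h1 : ∀ a, ∫ b, triangleArea m a b ∂(c • Measure.map F discMeasure)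
      = c.toReal * ∫ y, triangleArea m a (F y) ∂discMeasure := fun a => by
    rw [integral_smul_measure, smul_eq_mul, integral_map hF.aemeasurable]
    exact (hcont.comp (Continuous.prodMk_right a)).aestronglyMeasurable
  have hsm : StronglyMeasurable fun a => ∫ y, triangleArea m a (F y) ∂discMeasure := by
    refine StronglyMeasurable.integral_prod_right (f := fun a y => triangleArea m a (F y)) ?_
    exact (hcont.measurable.comp
      (measurable_fst.prodMk (hF.comp measurable_snd))).stronglyMeasurable
  unfold ojaObjective
  simp only [h1]
  rw [integral_const_mul, integral_smul_measure, smul_eq_mul,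
    integral_map hF.aemeasurable hsm.aestronglyMeasurable, integral_prod _ hint]
  ring

/-! ### The rescaled displacement of the image -/

/-- The second order part of `u` near `p` at the scale `ρ`, in the coordinates given by `L`. -/
def displacement (u : Plane → Plane) (p : Plane) (L : (ℝ × ℝ) ≃L[ℝ] Plane) (ρ : ℝ) :
    ℝ × ℝ → ℝ × ℝ :=
  disc.indicator fun x => (ρ ^ 2)⁻¹ • L.symm (u (p + ρ • toPlane x) - u p - ρ • L x)

variable {u : Plane → Plane} {p : Plane} {L : (ℝ × ℝ) ≃L[ℝ] Plane}

theorem apply_eq_displacement {ρ : ℝ} (hρ : ρ ≠ 0) {x : ℝ × ℝ} (hx : x ∈ disc) :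
    u (p + ρ • toPlane x) = u p + ρ • L (x + ρ • displacement u p L ρ x) := by
  rw [displacement, Set.indicator_of_mem hx, map_add, map_smul, map_smul, L.apply_symm_apply,
    smul_add, smul_smul, smul_smul, show ρ * ρ * (ρ ^ 2)⁻¹ = 1 by field_simp, one_smul]
  abel

theorem mapsTo_disc_closedBall {ρ : ℝ} (hρ : 0 ≤ ρ) :
    Set.MapsTo (fun x => p + ρ • toPlane x) disc (Metric.closedBall p ρ) := fun x hx => by
  rw [mem_closedBall_iff_norm, add_sub_cancel_left, norm_smul, Real.norm_of_nonneg hρ]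
  exact mul_le_of_le_one_right hρ (mem_disc_iff.1 hx)

theorem continuousOn_displacement_aux {ρ : ℝ} (hρ : 0 ≤ ρ)
    (hu : ContinuousOn u (Metric.closedBall p ρ)) :
    ContinuousOn (fun x => (ρ ^ 2)⁻¹ • L.symm (u (p + ρ • toPlane x) - u p - ρ • L x)) disc := by
  have h1 : ContinuousOn (fun x => u (p + ρ • toPlane x)) disc :=
    hu.comp (by fun_prop) (mapsTo_disc_closedBall hρ)
  have h2 : ContinuousOn (fun x => u (p + ρ • toPlane x) - u p - ρ • L x) disc :=
    (h1.sub continuousOn_const).sub (by fun_prop)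
  exact (L.symm.continuous.comp_continuousOn h2).const_smul ((ρ ^ 2)⁻¹)

theorem continuousOn_displacement {ρ : ℝ} (hρ : 0 ≤ ρ)
    (hu : ContinuousOn u (Metric.closedBall p ρ)) :
    ContinuousOn (displacement u p L ρ) disc :=
  (continuousOn_displacement_aux hρ hu).congr fun _ hx => Set.indicator_of_mem hx _

theorem measurable_displacement {ρ : ℝ} (hρ : 0 ≤ ρ)
    (hu : ContinuousOn u (Metric.closedBall p ρ)) : Measurable (displacement u p L ρ) := by
  classical
  rw [displacement, ← Set.piecewise_eq_indicator]
  exact (continuousOn_displacement_aux hρ hu).measurable_piecewise continuousOn_const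
    measurableSet_disc

theorem tendstoUniformlyOn_displacement (hu : ContDiffAt ℝ 2 u p)
    (hL : ∀ x, L x = fderiv ℝ u p (toPlane x)) {a b c : ℝ × ℝ}
    (hq : ∀ x, L (quadMap a b c x)
      = (1 / 2 : ℝ) • fderiv ℝ (fderiv ℝ u) p (toPlane x) (toPlane x)) :
    TendstoUniformlyOn (displacement u p L) (quadMap a b c) (𝓝[>] 0) disc := by
  rw [Metric.tendstoUniformlyOn_iff]
  intro ε hε
  set K := ‖(L.symm : Plane →L[ℝ] ℝ × ℝ)‖ with hK
  have hK0 : 0 ≤ K := norm_nonneg _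
  obtain ⟨δ, hδ, hT⟩ := norm_taylor_two_le hu (ε := ε / (K + 1)) (by positivity)
  filter_upwards [Ioo_mem_nhdsGT hδ] with ρ hρ x hx
  have hρ0 : 0 < ρ := hρ.1
  have hx1 : ‖toPlane x‖ ≤ 1 := mem_disc_iff.1 hx
  have hn : ‖ρ • toPlane x‖ ≤ ρ := by
    rw [norm_smul, Real.norm_of_nonneg hρ0.le]
    exact mul_le_of_le_one_right hρ0.le hx1
  have ht := hT (ρ • toPlane x) (hn.trans_lt hρ.2)
  set ψ := u (p + ρ • toPlane x) - u p - fderiv ℝ u p (ρ • toPlane x)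
      - (1 / 2 : ℝ) • fderiv ℝ (fderiv ℝ u) p (ρ • toPlane x) (ρ • toPlane x) with hψ
  have e : displacement u p L ρ x - quadMap a b c x = (ρ ^ 2)⁻¹ • L.symm ψ := by
    have h1 : ψ = (u (p + ρ • toPlane x) - u p - ρ • L x) - ρ ^ 2 • L (quadMap a b c x) := by
      rw [hψ, hq, hL]
      simp only [map_smul, smul_apply]
      congr 1
      module
    rw [h1, map_sub, map_smul L.symm (ρ ^ 2), L.symm_apply_apply, smul_sub, smul_smul,
      inv_mul_cancel₀ (by positivity), one_smul, displacement, Set.indicator_of_mem hx]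
  rw [dist_comm, dist_eq_norm, e, norm_smul, Real.norm_of_nonneg (by positivity)]
  have h2 : ‖L.symm ψ‖ ≤ K * ‖ψ‖ := (L.symm : Plane →L[ℝ] ℝ × ℝ).le_opNorm ψ
  have h3 : ‖ψ‖ ≤ ε / (K + 1) * ρ ^ 2 := ht.trans (by gcongr)
  calc (ρ ^ 2)⁻¹ * ‖L.symm ψ‖ ≤ (ρ ^ 2)⁻¹ * (K * (ε / (K + 1) * ρ ^ 2)) := by
        gcongr
        exact h2.trans (by gcongr)
    _ = ε * (K / (K + 1)) := by field_simp
    _ < ε * 1 := by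
        gcongr
        rw [div_lt_one (by positivity)]
        linarith
    _ = ε := mul_one ε

/-- Quantitative local surjectivity: `u` is approximated by its invertible derivative, so the image
of a ball of radius proportional to `ρ` contains a ball of radius proportional to `ρ`. After
rescaling the radius `κ` does not depend on `ρ`. -/
theorem eventually_displacement_surjective (hu : HasStrictFDerivAt u (fderiv ℝ u p) p)
    (hL : ∀ x, L x = fderiv ℝ u p (toPlane x)) :
    ∃ κ > 0, ∀ᶠ ρ in 𝓝[>] (0 : ℝ), ∀ y : ℝ × ℝ, ‖y‖ ≤ κ →
      ∃ x ∈ openDisc, x + ρ • displacement u p L ρ x = y := by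
  set M : Plane ≃L[ℝ] Plane := toPlane.symm.trans L with hM
  have hMu : (M : Plane →L[ℝ] Plane) = fderiv ℝ u p := by
    ext1 v
    simp [hM, hL]
  set R := M.toNonlinearRightInverse with hR
  have hR0 : 0 < R.nnnorm := by
    obtain ⟨v, hv⟩ := exists_ne (0 : Plane)
    by_contra! h
    have h1 := R.bound (M v)
    rw [nonpos_iff_eq_zero.1 h, NNReal.coe_zero, zero_mul, norm_le_zero_iff] at h1
    have h2 := R.right_inv (M v)
    rw [h1, map_zero] at h2
    exact hv (M.injective (h2.symm.trans M.map_zero.symm))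
  set k : NNReal := R.nnnorm⁻¹ / 2 with hk
  have hk0 : 0 < k := by positivity
  rw [← hMu] at hu
  obtain ⟨s, hs, happ⟩ := hu.approximates_deriv_on_nhds (c := k) (Or.inr hk0)
  obtain ⟨δ, hδ, hball⟩ := Metric.nhds_basis_closedBall.mem_iff.1 hs
  set N := ‖(L : ℝ × ℝ →L[ℝ] Plane)‖ with hN
  have hN0 : 0 ≤ N := norm_nonneg _
  have hk0' : (0 : ℝ) < k := hk0
  refine ⟨k / 2 / (N + 1), by positivity, ?_⟩
  filter_upwards [Ioo_mem_nhdsGT hδ] with ρ hρ y hy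
  have hρ0 : 0 < ρ := hρ.1
  -- Radius `ρ / 2` instead of `ρ` makes the preimages lie in the open disc.
  have hsurj := happ.surjOn_closedBall_of_nonlinearRightInverse R (ε := ρ / 2) (b := p)
    (by positivity) ((Metric.closedBall_subset_closedBall (by linarith [hρ.2])).trans hball)
  have hrad : ((R.nnnorm : ℝ)⁻¹ - k) * (ρ / 2) = k / 2 * ρ := by
    rw [hk]; push_cast; ring
  rw [hrad] at hsurj
  have hLy : u p + ρ • L y ∈ Metric.closedBall (u p) (k / 2 * ρ) := by
    rw [mem_closedBall_iff_norm, add_sub_cancel_left, norm_smul, Real.norm_of_nonneg hρ0.le,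
      mul_comm]
    gcongr
    calc ‖L y‖ ≤ N * ‖y‖ := (L : ℝ × ℝ →L[ℝ] Plane).le_opNorm y
      _ ≤ (N + 1) * (k / 2 / (N + 1)) := by gcongr; linarith
      _ = k / 2 := by field_simp
  obtain ⟨q, hq, hqy⟩ := hsurj hLy
  set x := toPlane.symm (ρ⁻¹ • (q - p)) with hx
  have hxq : p + ρ • toPlane x = q := by
    rw [hx, toPlane.apply_symm_apply, smul_smul, mul_inv_cancel₀ hρ0.ne', one_smul]
    abel
  have hxd : x ∈ openDisc := by
    rw [mem_openDisc_iff, hx, toPlane.apply_symm_apply, norm_smul, norm_inv,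
      Real.norm_of_nonneg hρ0.le]
    rw [mem_closedBall_iff_norm] at hq
    calc ρ⁻¹ * ‖q - p‖ ≤ ρ⁻¹ * (ρ / 2) := by gcongr
      _ = 1 / 2 := by field_simp
      _ < 1 := by norm_num
  refine ⟨x, hxd, ?_⟩
  have h1 := apply_eq_displacement (u := u) (p := p) (L := L) hρ0.ne' (openDisc_subset_disc hxd)
  rw [hxq, hqy] at h1
  exact (L.injective (smul_right_injective Plane hρ0.ne' (add_left_cancel h1))).symm

/-- The normalisation of the uniform distribution and the determinant of the basis enter only as a
positive factor of the objective, and every point of the plane has the form `u p + ρ ^ 2 • L n`. -/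
theorem isOjaFilterValue_iff {a b : Plane} (h : a 0 * b 1 - b 0 * a 1 ≠ 0) {ρ : ℝ} (hρ : 0 < ρ)
    (hu : ContinuousOn u (Metric.closedBall p ρ)) (n : ℝ × ℝ) :
    IsOjaFilterValue u p ρ (u p + ρ ^ 2 • basisEquiv a b h n)
      ↔ IsAreaMinimiser ρ (displacement u p (basisEquiv a b h) ρ) n := by
  set L := basisEquiv a b h with hL
  set W := displacement u p L ρ with hW
  have hWm : Measurable W := measurable_displacement hρ.le hu
  obtain ⟨C, hC⟩ := isCompact_disc.exists_bound_of_continuousOn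
    (continuousOn_displacement (L := L) hρ.le hu)
  obtain ⟨c, hc0, hct, hc⟩ := cond_closedBall_eq p hρ
  set T : ℝ × ℝ → Plane := fun x => p + ρ • toPlane x with hT
  set F : ℝ × ℝ → Plane := fun x => u p + ρ • L (x + ρ • W x) with hF
  have hFm : Measurable F :=
    ((L.continuous.measurable.comp (measurable_id.add (hWm.const_smul ρ))).const_smul ρ).const_add _
  have hTm : Measurable T := ((toPlane.continuous.const_smul ρ).const_add p).measurable
  -- Continuity of `u` is known only on the closed ball, so measurability is available only almost
  -- everywhere.
  have hau : AEMeasurable u (cond volume (Metric.closedBall p ρ)) := by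
    rw [ProbabilityTheory.cond]
    exact (hu.aemeasurable Metric.isClosed_closedBall.measurableSet).smul_measure _
  have hauT : AEMeasurable u (Measure.map T discMeasure) := by
    rw [hc] at hau
    exact (aemeasurable_smul_measure_iff hc0).1 hau
  have hdist : valueDistribution u p ρ = c • Measure.map F discMeasure := by
    rw [valueDistribution, hc, Measure.map_smul, hauT.map_map_of_aemeasurable hTm.aemeasurable]
    congr 1
    refine Measure.map_congr ?_
    filter_upwards [ae_restrict_mem measurableSet_disc] with x hx
    exact apply_eq_displacement hρ.ne' hx
  have harea : ∀ n x y, triangleArea (u p + ρ ^ 2 • L n) (F x) (F y)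
      = ρ ^ 2 * |a 0 * b 1 - b 0 * a 1| / 2 * areaIntegrand ρ (fun x => W x - n) (x, y) := by
    intro n x y
    have e : u p + ρ ^ 2 • L n = u p + ρ • L (ρ • n) := by
      rw [map_smul, smul_smul, sq]
    rw [e, triangleArea_basisEquiv h, areaIntegrand]
    simp only [smul_sub, ← add_sub_assoc]
  set K := c.toReal ^ 2 * (ρ ^ 2 * |a 0 * b 1 - b 0 * a 1| / 2) with hK
  have hKpos : 0 < K := by
    have := ENNReal.toReal_pos hc0 hct
    have := abs_pos.2 h
    positivity
  have hobj : ∀ n, ojaObjective (valueDistribution u p ρ) (u p + ρ ^ 2 • L n)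
      = K * areaIntegral ρ fun x => W x - n := by
    intro n
    have hint : Integrable (fun z => triangleArea (u p + ρ ^ 2 • L n) (F z.1) (F z.2))
        (discMeasure.prod discMeasure) := by
      simp only [harea]
      exact (integrable_areaIntegrand_sub ρ hWm hC n).const_mul _
    rw [hdist, ojaObjective_smul_map hFm _ hint]
    simp only [harea]
    rw [integral_const_mul, hK, mul_assoc]
    rfl
  have hall : ∀ m, ∃ n, m = u p + ρ ^ 2 • L n := fun m =>
    ⟨(ρ ^ 2)⁻¹ • L.symm (m - u p), by
      rw [map_smul, smul_smul, mul_inv_cancel₀ (by positivity), one_smul, L.apply_symm_apply]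
      abel⟩
  constructor
  · intro hm n'
    have := hm (u p + ρ ^ 2 • L n')
    rw [hobj, hobj] at this
    exact le_of_mul_le_mul_left this hKpos
  · intro hm m'
    obtain ⟨n', rfl⟩ := hall m'
    rw [hobj, hobj]
    exact mul_le_mul_of_nonneg_left (hm n') hKpos.le

/-! ### Second derivatives and the right-hand side of the PDE system -/

theorem partialDeriv_partialDeriv {u : Plane → Plane} {p : Plane} (hu : ContDiffAt ℝ 2 u p)
    (i j : Fin 2) :
    partialDeriv j (partialDeriv i u) p = fderiv ℝ (fderiv ℝ u) p (EuclideanSpace.single j 1)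
      (EuclideanSpace.single i 1) := by
  have hdu : DifferentiableAt ℝ (fderiv ℝ u) p :=
    (hu.fderiv_right (m := 1) (by norm_num)).differentiableAt (by norm_num)
  have h := hdu.hasFDerivAt.clm_apply
    (hasFDerivAt_const (EuclideanSpace.single i (1 : ℝ) : Plane) p)
  rw [partialDeriv, show partialDeriv i u
    = fun q => fderiv ℝ u q (EuclideanSpace.single i 1) from rfl, h.fderiv]
  simp

theorem det_jacobian (u : Plane → Plane) (p : Plane) :
    (jacobian u p).det = partialDeriv 0 u p 0 * partialDeriv 1 u p 1
      - partialDeriv 1 u p 0 * partialDeriv 0 u p 1 := by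
  rw [Matrix.det_fin_two]
  rfl

theorem basisEquiv_partialDeriv {u : Plane → Plane} {p : Plane}
    (h : partialDeriv 0 u p 0 * partialDeriv 1 u p 1
      - partialDeriv 1 u p 0 * partialDeriv 0 u p 1 ≠ 0) (x : ℝ × ℝ) :
    basisEquiv (partialDeriv 0 u p) (partialDeriv 1 u p) h x = fderiv ℝ u p (toPlane x) := by
  rw [toPlane_eq, map_add, map_smul, map_smul]
  rfl

theorem basisEquiv_quadMap {u : Plane → Plane} {p : Plane} (hu : ContDiffAt ℝ 2 u p)
    (L : (ℝ × ℝ) ≃L[ℝ] Plane) (x : ℝ × ℝ) :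
    L (quadMap ((1 / 2 : ℝ) • L.symm (partialDeriv 0 (partialDeriv 0 u) p))
        (L.symm (partialDeriv 1 (partialDeriv 0 u) p))
        ((1 / 2 : ℝ) • L.symm (partialDeriv 1 (partialDeriv 1 u) p)) x)
      = (1 / 2 : ℝ) • fderiv ℝ (fderiv ℝ u) p (toPlane x) (toPlane x) := by
  have hsymm : ∀ v w, fderiv ℝ (fderiv ℝ u) p v w = fderiv ℝ (fderiv ℝ u) p w v :=
    hu.isSymmSndFDerivAt (by simp)
  simp only [quadMap, map_add, map_smul, L.apply_symm_apply, partialDeriv_partialDeriv hu,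
    toPlane_eq, add_apply, smul_apply]
  rw [hsymm (EuclideanSpace.single 0 1) (EuclideanSpace.single 1 1)]
  module

theorem smul_mulVec_two (k a b c d x y : ℝ) :
    (k • !![a, b; c, d]) *ᵥ ![x, y] = ![k * (a * x + b * y), k * (c * x + d * y)] := by
  ext i
  fin_cases i
  · simp only [Matrix.mulVec, dotProduct, Fin.sum_univ_two]
    simp
    ring
  · simp only [Matrix.mulVec, dotProduct, Fin.sum_univ_two]
    simp
    ring

theorem pdeRHS_eq {u : Plane → Plane} {p : Plane}
    (h : partialDeriv 0 u p 0 * partialDeriv 1 u p 1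
      - partialDeriv 1 u p 0 * partialDeriv 0 u p 1 ≠ 0) {L : (ℝ × ℝ) ≃L[ℝ] Plane}
    (hL : L = basisEquiv (partialDeriv 0 u p) (partialDeriv 1 u p) h) :
    pdeRHS u p = (24 : ℝ) • L (limitMinimiser
      ((1 / 2 : ℝ) • L.symm (partialDeriv 0 (partialDeriv 0 u) p))
      (L.symm (partialDeriv 1 (partialDeriv 0 u) p))
      ((1 / 2 : ℝ) • L.symm (partialDeriv 1 (partialDeriv 1 u) p))) := by
  have hLx : ∀ x, L x = x.1 • partialDeriv 0 u p + x.2 • partialDeriv 1 u p := fun x => by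
    rw [hL]; rfl
  -- Writing the second derivatives as images under `L` removes `L.symm`; the Jacobian determinant
  -- is then the only denominator, and the claim is a polynomial identity.
  obtain ⟨α, hα⟩ : ∃ α, L α = partialDeriv 0 (partialDeriv 0 u) p := L.surjective _
  obtain ⟨β, hβ⟩ : ∃ β, L β = partialDeriv 1 (partialDeriv 0 u) p := L.surjective _
  obtain ⟨γ, hγ⟩ : ∃ γ, L γ = partialDeriv 1 (partialDeriv 1 u) p := L.surjective _
  unfold pdeRHS coeffA coeffB
  simp only [← hα, ← hβ, ← hγ, L.symm_apply_apply, limitMinimiser, jacobian, Matrix.of_apply]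
  generalize partialDeriv 0 u p = a at *
  generalize partialDeriv 1 u p = b at *
  rw [smul_mulVec_two, smul_mulVec_two]
  obtain ⟨d, hd⟩ : ∃ d, d = a 0 * b 1 - b 0 * a 1 := ⟨_, rfl⟩
  rw [← hd] at h ⊢
  ext i
  fin_cases i
  · simp [hLx]
    field_simp
    rw [hd]
    ring
  · simp [hLx]
    field_simp
    rw [hd]
    ring

end OjaFilter

end

theorem mainTheorem1 (Ω : Set OjaFilter.Plane) (hΩ : IsOpen Ω)
    (u : OjaFilter.Plane → OjaFilter.Plane) (hu : ContDiffOn ℝ 2 u Ω)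
    (p : OjaFilter.Plane) (hp : p ∈ Ω) (hdet : (OjaFilter.jacobian u p).det ≠ 0) :
    (∀ᶠ ρ : ℝ in 𝓝[>] 0, ∃! m : OjaFilter.Plane, OjaFilter.IsOjaFilterValue u p ρ m) ∧
    (∀ m : ℝ → OjaFilter.Plane,
      (∀ᶠ ρ : ℝ in 𝓝[>] 0, OjaFilter.IsOjaFilterValue u p ρ (m ρ)) →
      (fun ρ : ℝ => m ρ - OjaFilter.explicitStep u p (ρ ^ 2 / 24))
        =o[𝓝[>] 0] fun ρ : ℝ => ρ ^ 2) ∧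
    (OjaFilter.jacobian u p = 1 →
      OjaFilter.pdeRHS u p =
        !₂[OjaFilter.partialDeriv 0 (OjaFilter.partialDeriv 0 u) p 0
            + 3 * OjaFilter.partialDeriv 1 (OjaFilter.partialDeriv 1 u) p 0
            - 2 * OjaFilter.partialDeriv 1 (OjaFilter.partialDeriv 0 u) p 1,
          3 * OjaFilter.partialDeriv 0 (OjaFilter.partialDeriv 0 u) p 1
            + OjaFilter.partialDeriv 1 (OjaFilter.partialDeriv 1 u) p 1
            - 2 * OjaFilter.partialDeriv 1 (OjaFilter.partialDeriv 0 u) p 0]) := by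
  have hup : ContDiffAt ℝ 2 u p := hu.contDiffAt (hΩ.mem_nhds hp)
  rw [OjaFilter.det_jacobian] at hdet
  obtain ⟨L, hL⟩ : ∃ L, L = OjaFilter.basisEquiv (OjaFilter.partialDeriv 0 u p)
    (OjaFilter.partialDeriv 1 u p) hdet := ⟨_, rfl⟩
  have hLx : ∀ x, L x = fderiv ℝ u p (OjaFilter.toPlane x) := fun x => by
    rw [hL, OjaFilter.basisEquiv_partialDeriv]
  obtain ⟨n₀, hn₀⟩ : ∃ n₀, n₀ = OjaFilter.limitMinimiser
    ((1 / 2 : ℝ) • L.symm (OjaFilter.partialDeriv 0 (OjaFilter.partialDeriv 0 u) p))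
    (L.symm (OjaFilter.partialDeriv 1 (OjaFilter.partialDeriv 0 u) p))
    ((1 / 2 : ℝ) • L.symm (OjaFilter.partialDeriv 1 (OjaFilter.partialDeriv 1 u) p)) := ⟨_, rfl⟩
  have hrhs : OjaFilter.pdeRHS u p = (24 : ℝ) • L n₀ := by
    rw [hn₀]; exact OjaFilter.pdeRHS_eq hdet hL
  have hpos : ∀ᶠ ρ in 𝓝[>] (0 : ℝ), 0 < ρ := eventually_mem_nhdsWithin
  have hcont : ∀ᶠ ρ in 𝓝[>] (0 : ℝ), ContinuousOn u (Metric.closedBall p ρ) := by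
    obtain ⟨δ, hδ, hsub⟩ := Metric.nhds_basis_closedBall.mem_iff.1 (hΩ.mem_nhds hp)
    filter_upwards [Ioo_mem_nhdsGT hδ] with ρ hρ
    exact hu.continuousOn.mono ((Metric.closedBall_subset_closedBall hρ.2.le).trans hsub)
  obtain ⟨κ, hκ, hsurj⟩ := OjaFilter.eventually_displacement_surjective
    (hup.hasStrictFDerivAt (by norm_num)) hLx
  have hmin : ∀ ε > 0, ∀ᶠ ρ in 𝓝[>] (0 : ℝ),
      (∃! n, OjaFilter.IsAreaMinimiser ρ (OjaFilter.displacement u p L ρ) n) ∧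
      ∀ n, OjaFilter.IsAreaMinimiser ρ (OjaFilter.displacement u p L ρ) n → dist n n₀ < ε := by
    intro ε hε
    rw [hn₀]
    refine OjaFilter.eventually_areaMinimiser hκ ?_ ?_
      (OjaFilter.tendstoUniformlyOn_displacement hup hLx (OjaFilter.basisEquiv_quadMap hup L))
      hsurj hε
    · filter_upwards [hpos, hcont] with ρ h1 h2 using OjaFilter.measurable_displacement h1.le h2
    · filter_upwards [hpos, hcont] with ρ h1 h2 using OjaFilter.continuousOn_displacement h1.le h2
  have hiff : ∀ᶠ ρ in 𝓝[>] (0 : ℝ), ∀ n,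
      OjaFilter.IsOjaFilterValue u p ρ (u p + ρ ^ 2 • L n)
        ↔ OjaFilter.IsAreaMinimiser ρ (OjaFilter.displacement u p L ρ) n := by
    filter_upwards [hpos, hcont] with ρ h1 h2 n
    rw [hL]
    exact OjaFilter.isOjaFilterValue_iff hdet h1 h2 n
  have hall : ∀ ρ : ℝ, 0 < ρ → ∀ m, ∃ n, m = u p + ρ ^ 2 • L n := fun ρ hρ m =>
    ⟨(ρ ^ 2)⁻¹ • L.symm (m - u p), by
      rw [map_smul, smul_smul, mul_inv_cancel₀ (by positivity), one_smul, L.apply_symm_apply]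
      abel⟩
  refine ⟨?_, ?_, ?_⟩
  · filter_upwards [hmin 1 one_pos, hiff, hpos] with ρ h1 h2 h3
    obtain ⟨n, hn, huniq⟩ := h1.1
    refine ⟨u p + ρ ^ 2 • L n, (h2 n).2 hn, fun m hm => ?_⟩
    obtain ⟨n', rfl⟩ := hall ρ h3 m
    rw [huniq n' ((h2 n').1 hm)]
  · intro m hm
    rw [isLittleO_iff]
    intro ε hε
    set N := ‖(L : ℝ × ℝ →L[ℝ] OjaFilter.Plane)‖ with hN
    have hN0 : 0 ≤ N := norm_nonneg _
    -- The error is `ρ ^ 2 • L (n - n₀)`; the `+ 1` keeps the denominator positive without a lower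
    -- bound on `N`.
    filter_upwards [hmin (ε / (N + 1)) (by positivity), hiff, hpos, hm] with ρ h1 h2 h3 h4
    obtain ⟨n, hn⟩ := hall ρ h3 (m ρ)
    rw [hn] at h4 ⊢
    have h5 := h1.2 n ((h2 n).1 h4)
    rw [dist_eq_norm] at h5
    have e : u p + ρ ^ 2 • L n - OjaFilter.explicitStep u p (ρ ^ 2 / 24)
        = ρ ^ 2 • L (n - n₀) := by
      rw [OjaFilter.explicitStep, hrhs, map_sub]
      module
    rw [e, norm_smul, mul_comm]
    gcongr
    calc ‖L (n - n₀)‖ ≤ N * ‖n - n₀‖ := (L : ℝ × ℝ →L[ℝ] OjaFilter.Plane).le_opNorm _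
      _ ≤ (N + 1) * (ε / (N + 1)) := by gcongr; linarith
      _ = ε := by field_simp
  · intro hJ
    unfold OjaFilter.pdeRHS OjaFilter.coeffA OjaFilter.coeffB
    simp only [hJ, OjaFilter.smul_mulVec_two]
    ext i
    fin_cases i
    · simp
      ring
    · simp
      ring
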